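/- Let $D$ be a principal ideal domain with quotient field $K$, let $B\in M_n(D)$, let $p$ be a prime element of $D$, and let $\mu_B$ be the minimal polynomial of $B$ over $K$. For $a\in D$ let $N_a(B)=\{f\in D[X] : f(B)\in M_n(aD)\}$. A $(p^t)$-minimal polynomial of $B$ is a monic polynomial of minimal degree among the monic polynomials in $N_{p^t}(B)$. Let $\chi_B$ be the characteristic polynomial of $B$, let $\boldsymbol b=(b_1,\dots,b_{n^2})$ be the column of the entries of $\operatorname{adj}(X-B)$ in any fixed order, let $A=(\boldsymbol b\mid -\chi_B I)\in M_{n^2,n^2+1}(D[X])$, and let $M_t=\{\boldsymbol f\in D[X]^{n^2+1} : A\boldsymbol f\equiv 0 \pmod{p^t}\}$. A bar denotes reduction modulo $p$. Consider the following algorithms, in which every "choose", "write", "let" leaves all possible choices open. **Main algorithm.** Start with $t:=0$, $\mathcal S:=\emptyset$, $\nu_0:=1$, and $G$ the $(n^2+1)\times 0$ matrix. Repeat: (1) $t:=t+1$, and obtain from $G$ by Lifting a matrix $F$; (2) let $\mathcal F$ be the set of entries of the first row of $F$, and obtain $\nu_t$ from $\mathcal F$ and $\nu_{t-1}$ by Reduction;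 (3) if $\deg\nu_t\ge\deg\mu_B$, return $\mathcal S$ and $(\nu_s)_{s\in\mathcal S}$; (4) divide with remainder, $\nu_tb_i=g_i\chi_B+r_i$ with $\deg r_i<\deg\chi_B$ for $1\le i\le n^2$; (5) if $\deg\nu_t=\deg\nu_{t-1}$, delete the last column of $G$ and remove $t-1$ from $\mathcal S$; (6) replace $G$ by $pG$ with the additional last column $(\nu_t,g_1,\dots,g_{n^2})^{T}$, and add $t$ to $\mathcal S$. **Lifting** (of $G$ with $s$ columns, from $t-1$ to $t$). Let $R=p^{-(t-1)}AG$. Choose $S$, $T$ over $D[X]$ with $\overline S$, $\overline T$ invertible such that $\overline S\,(\overline A\mid\overline R)\,\overline T=\operatorname{diag}_{n^2\times(n^2+1+s)}(\overline\alpha_1,\dots,\overline\alpha_{n^2})$ with $\overline\alpha_1\mid\overline\alpha_2\mid\cdots\mid\overline\alpha_{n^2}$ (Smith normal form). Let $F$ consist of the last $s+1$ columns of $(p^{t-1}I\mid G)\,T$. **Reduction** (of $\mathcal F$, using $\nu_{t-1}$). Delete all elements of $\mathcal F\cap pD[X]$ from $\mathcal F$, and then replace each non-monic element of $\mathcal F$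 by the polynomials that Replacement returns for it. Choose $g\in\mathcal F$ of minimal degree. While there is $f\in\mathcal F$ with $f\ne g$: remove $f$ from $\mathcal F$ and write $f=qg+r$ with $\deg r<\deg g$; if $r\notin pD[X]$, let $h_1,\dots,h_m$ be the output of Replacement for $r$, add them to $\mathcal F$ and put $g:=h_m$. Return $\nu_t:=g$. **Replacement** (of $f$, using $\nu_{t-1}$). Put $f_0:=f$. While the current $f_{i-1}\notin pD[X]$ (for $i=1,2,\dots$): write $f_{i-1}=k_1+pk_2$ such that no non-zero coefficient of $k_1$ is divisible by $p$; let $r$ be the remainder of $k_2$ modulo $\nu_{t-1}$; choose $u,v\in D$ with $u\operatorname{lc}(k_1)+vp=1$; put $h_i:=u(k_1+pr)+vX^{\deg k_1-\deg\nu_{t-1}}p\,\nu_{t-1}$, and let $f_i$ be the remainder of $f_{i-1}$ modulo $h_i$. Return the $h_1,h_2,\dots$ found. **Theorem.** For every $B\in M_n(D)$ and every prime element $p$ of $D$, the main algorithm terminates and is correct. That is, whatever choices are made, no run is infinite, every step can be carried out until the algorithm returns, and the following hold. * At the start of each pass through the loop the columns of $(p^{t}I\mid G)$ generate $M_{t}$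 (for the value of $t$ before it is incremented). After step (1) the columns of $(p^tI\mid F\mid pG)$ generate $M_t$, and the set $\mathcal F$ of step (2) satisfies $N_{p^t}(B)=(\mathcal F)+pN_{p^{t-1}}(B)$. After step (2), $\nu_t$ is a $(p^t)$-minimal polynomial of $B$. * $\mu_B\in D[X]$, and the output $\mathcal S$, $(\nu_s)_{s\in\mathcal S}$ has the following properties. $\mathcal S$ is a finite set of positive integers. For each $s\in\mathcal S$, $\nu_s$ is a $(p^s)$-minimal polynomial of $B$. The degree of $\nu_s$ is strictly increasing in $s\in\mathcal S$. For all $t\ge1$, $$N_{p^t}(B)=\mu_BD[X]+p^tD[X]+\sum_{\substack{s\in\mathcal S\\ s\le b(t)}}p^{\max\{0,t-s\}}\nu_sD[X],\qquad b(t)=\inf\{r\in\mathcal S : r\ge t\}\quad(\inf\emptyset=\infty).$$ If $\mathcal S\neq\emptyset$ and $1\le t\le\max\mathcal S$, the summand $\mu_BD[X]$ can be omitted. -/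

import Mathlib

open Polynomial

noncomputable section

namespace PMinimal

universe u v

section Basic

variable {R : Type u} [CommRing R]

/-- The `J`-ideal of a square matrix `B` over a commutative ring `R`:
all `f ∈ R[X]` such that every entry of `f(B)` lies in `J`. -/
def nullIdeal {n : ℕ} (J : Ideal R) (B : Matrix (Fin n) (Fin n) R) : Ideal R[X] where
  carrier := {f | ∀ i j, (aeval B f) i j ∈ J}
  zero_mem' := by
    intro i j
    simp
  add_mem' := by
    intro f g hf hg i j
    simpa using J.add_mem (hf i j) (hg i j)
  smul_mem' := by
    intro c f hf i j
    simp only [smul_eq_mul, map_mul, Matrix.mul_apply]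
    exact J.sum_mem fun k _ => J.mul_mem_left _ (hf k j)

/-- `ν` is a `J`-minimal polynomial of `B`: it is monic, lies in the `J`-ideal of `B`, and has
minimal degree among the monic polynomials of that ideal. -/
def IsMinimalPoly {n : ℕ} (J : Ideal R) (B : Matrix (Fin n) (Fin n) R) (ν : R[X]) : Prop :=
  ν.Monic ∧ ν ∈ nullIdeal J B ∧ ∀ g : R[X], g.Monic → g ∈ nullIdeal J B → ν.degree ≤ g.degree

/-- The `(a)`-ideal of `B`. -/
def nullIdealOf {n : ℕ} (a : R) (B : Matrix (Fin n) (Fin n) R) : Ideal R[X] :=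
  nullIdeal (Ideal.span {a}) B

/-- The set `F` has the `(p ^ t)`-generating property with respect to `B` (`t ≥ 1`):
the `(p ^ t)`-ideal is `(F)` plus `p` times the `(p ^ (t - 1))`-ideal. -/
def HasGeneratingProperty {n : ℕ} (p : R) (B : Matrix (Fin n) (Fin n) R) (t : ℕ)
    (F : Set R[X]) : Prop :=
  nullIdealOf (p ^ t) B = Ideal.span F ⊔ Ideal.span {C p} * nullIdealOf (p ^ (t - 1)) B

/-- The `R[X]`-module of all vectors `f` of polynomials with `A f ≡ 0 (mod p ^ t)`. -/
def congruenceModule {κ δ : Type*} [Fintype δ] (p : R) (t : ℕ) (A : Matrix κ δ R[X]) :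
    Submodule R[X] (δ → R[X]) where
  carrier := {f | ∀ i, C (p ^ t) ∣ (A.mulVec f) i}
  zero_mem' := by
    intro i
    simp
  add_mem' := by
    intro f g hf hg i
    simpa [Matrix.mulVec_add] using dvd_add (hf i) (hg i)
  smul_mem' := by
    intro c f hf i
    simpa [Matrix.mulVec_smul] using (hf i).mul_left c

/-- The columns of the matrix `M` generate the module `N`. -/
def ColumnsGenerate {δ γ : Type*} (M : Matrix δ γ R[X]) (N : Submodule R[X] (δ → R[X])) : Prop :=
  Submodule.span R[X] (Set.range fun j i => M i j) = N

/-- The matrix with the given list of columns. -/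
def ofColumns {δ : Type*} (G : List (δ → R[X])) : Matrix δ (Fin G.length) R[X] :=
  Matrix.of fun i j => G.get j i

/-- Reduction of a matrix of polynomials modulo `p`. -/
def reduceMod {κ δ : Type*} (p : R) (M : Matrix κ δ R[X]) :
    Matrix κ δ (R ⧸ Ideal.span {p})[X] :=
  M.map (Polynomial.map (Ideal.Quotient.mk (Ideal.span {p})))

/-- The matrix `(b | -χ_B I)`, where `b` is the column of all entries of `adj (X - B)`, listed in
the order `e`, and `χ_B` is the characteristic polynomial of `B`. -/
def mcCoyMatrix {n : ℕ} (e : Fin (n ^ 2) ≃ Fin n × Fin n) (B : Matrix (Fin n) (Fin n) R) :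
    Matrix (Fin (n ^ 2)) (Fin 1 ⊕ Fin (n ^ 2)) R[X] :=
  Matrix.fromCols
    (Matrix.of fun i _ => B.charmatrix.adjugate (e i).1 (e i).2)
    (-(B.charpoly • (1 : Matrix (Fin (n ^ 2)) (Fin (n ^ 2)) R[X])))

end Basic

section Algorithms

variable {D : Type u} [CommRing D]

/-- **Lifting.** `Lifting p t A G F`: the lifting procedure, run on a matrix `G` (meant to satisfy
that the columns of `(p ^ t I | G)` generate the module of solutions of `A f ≡ 0 (mod p ^ t)`), can
return the matrix `F` (meant to satisfy that the columns of `(p ^ (t+1) I | F | p G)` generate the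
module of solutions of `A f ≡ 0 (mod p ^ (t+1))`).  The procedure

* puts `R := p ^ (-t) A G`,
* chooses `S` and `T`, invertible modulo `p`, such that modulo `p` the matrix `S (A | R) T` is in
  Smith normal form `diag (α₁, …, α_c)`, `α₁ ∣ ⋯ ∣ α_c`,
* lets `F` consist of the columns of `(p ^ t I | G) T` after the first `c` ones.

The columns of `T` are indexed by `Fin c ⊕ Fin e`: first `c` columns, last `e` columns. -/
def Lifting {δ : Type} [Fintype δ] [DecidableEq δ] {c s e : ℕ} (p : D) (t : ℕ)
    (A : Matrix (Fin c) δ D[X]) (G : Matrix δ (Fin s) D[X]) (F : Matrix δ (Fin e) D[X]) : Prop :=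
  ∃ (R : Matrix (Fin c) (Fin s) D[X]) (S : Matrix (Fin c) (Fin c) D[X])
    (T : Matrix (δ ⊕ Fin s) (Fin c ⊕ Fin e) D[X])
    (T' : Matrix (Fin c ⊕ Fin e) (δ ⊕ Fin s) (D ⧸ Ideal.span {p})[X])
    (α : Fin c → (D ⧸ Ideal.span {p})[X]),
    C (p ^ t) • R = A * G ∧
    IsUnit (reduceMod p S) ∧
    reduceMod p T * T' = 1 ∧ T' * reduceMod p T = 1 ∧
    (∀ i j, i ≤ j → α i ∣ α j) ∧
    reduceMod p S * reduceMod p (Matrix.fromCols A R) * reduceMod p T =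
      Matrix.fromCols (Matrix.diagonal α) 0 ∧
    F = (Matrix.fromCols (C (p ^ t) • (1 : Matrix δ δ D[X])) G * T).toCols₂

/-- **Find monic polynomial.** `FindMonic p ν f h`: on input `f` and the previous minimal
polynomial `ν`, the procedure can return `h`.  It writes `f = f₁ + p f₂` with no nonzero
coefficient of `f₁` divisible by `p`, divides `f₂` by `ν` with remainder `r`, chooses `u`, `v` with
`u lc(f₁) + v p = 1` and returns `u (f₁ + p r) + v X ^ (deg f₁ - deg ν) p ν`. -/
def FindMonic (p : D) (ν f h : D[X]) : Prop :=
  ∃ (f₁ f₂ q r : D[X]) (u v : D) (k : ℕ),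
    f = f₁ + C p * f₂ ∧
    (∀ i, f₁.coeff i ≠ 0 → ¬ p ∣ f₁.coeff i) ∧
    f₂ = q * ν + r ∧ r.degree < ν.degree ∧
    u * f₁.leadingCoeff + v * p = 1 ∧
    ν.natDegree + k = f₁.natDegree ∧
    h = C u * (f₁ + C p * r) + C v * X ^ k * (C p * ν)

/-- States of the procedure **Replacing by monic polynomials**:
the current polynomial `f_i` and the list `h₁, …, h_i` found so far. -/
structure ReplaceState (D : Type u) [CommRing D] where
  f : D[X]
  hs : List D[X]

/-- One iteration of the loop "while `f_i ∉ p D[X]`" of **Replacing by monic polynomials**. -/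
inductive ReplaceStep (p : D) (ν : D[X]) : ReplaceState D → ReplaceState D → Prop
  | iterate (f h q r : D[X]) (hs : List D[X])
      (hf : ¬ C p ∣ f) (hh : FindMonic p ν f h)
      (hdiv : f = q * h + r) (hr : r.degree < h.degree) :
      ReplaceStep p ν ⟨f, hs⟩ ⟨r, hs ++ [h]⟩

/-- States of the procedure **Computation of a `(p ^ t)`-minimal polynomial**. -/
inductive ReduceState (D : Type u) [CommRing D]
  /-- The input, a finite set of polynomials. -/
  | start (F : Finset D[X])
  /-- Non-monic members of `F` are being replaced by monic ones. -/
  | normalize (F : Finset D[X])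
  /-- A subroutine call replacing a non-monic polynomial, which has been removed from `F`. -/
  | normalizeCall (F : Finset D[X]) (c : ReplaceState D)
  /-- The head of the while loop. -/
  | loop (F : Finset D[X]) (g : D[X])
  /-- A subroutine call inside the while loop. -/
  | loopCall (F : Finset D[X]) (c : ReplaceState D)
  /-- The procedure has returned `g`. -/
  | halt (g : D[X])

open Classical in
/-- The steps of **Computation of a `(p ^ t)`-minimal polynomial**, where `ν` is the previous
minimal polynomial. -/
inductive ReduceStep (p : D) (ν : D[X]) : ReduceState D → ReduceState D → Prop
  /-- Delete all members of `p D[X]`. -/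
  | delete (F : Finset D[X]) :
      ReduceStep p ν (.start F) (.normalize (F.filter fun f => ¬ C p ∣ f))
  /-- Choose a non-monic member and start replacing it. -/
  | normalizeCall (F : Finset D[X]) (f : D[X]) (hf : f ∈ F) (hm : ¬ f.Monic) :
      ReduceStep p ν (.normalize F) (.normalizeCall (F.erase f) ⟨f, []⟩)
  | normalizeRun (F : Finset D[X]) (c c' : ReplaceState D) (hc : ReplaceStep p ν c c') :
      ReduceStep p ν (.normalizeCall F c) (.normalizeCall F c')
  | normalizeReturn (F : Finset D[X]) (f : D[X]) (hs : List D[X]) (hf : C p ∣ f) :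
      ReduceStep p ν (.normalizeCall F ⟨f, hs⟩) (.normalize (F ∪ hs.toFinset))
  /-- All members are monic; choose a member `g` of minimal degree. -/
  | chooseMin (F : Finset D[X]) (g : D[X]) (hF : ∀ f ∈ F, f.Monic) (hg : g ∈ F)
      (hmin : ∀ f ∈ F, g.degree ≤ f.degree) :
      ReduceStep p ν (.normalize F) (.loop F g)
  /-- The loop body for a remainder in `p D[X]`. -/
  | remove (F : Finset D[X]) (g f q r : D[X]) (hf : f ∈ F) (hfg : f ≠ g)
      (hdiv : f = q * g + r) (hr : r.degree < g.degree) (hp : C p ∣ r) :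
      ReduceStep p ν (.loop F g) (.loop (F.erase f) g)
  /-- The loop body for a remainder not in `p D[X]`: call the subroutine on the remainder. -/
  | loopCall (F : Finset D[X]) (g f q r : D[X]) (hf : f ∈ F) (hfg : f ≠ g)
      (hdiv : f = q * g + r) (hr : r.degree < g.degree) (hp : ¬ C p ∣ r) :
      ReduceStep p ν (.loop F g) (.loopCall (F.erase f) ⟨r, []⟩)
  | loopRun (F : Finset D[X]) (c c' : ReplaceState D) (hc : ReplaceStep p ν c c') :
      ReduceStep p ν (.loopCall F c) (.loopCall F c')
  /-- The subroutine has returned `h₁, …, h_s`: put `g := h_s` and add all `h_i` to the set. -/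
  | loopReturn (F : Finset D[X]) (f : D[X]) (hs : List D[X]) (h : D[X]) (hf : C p ∣ f) :
      ReduceStep p ν (.loopCall F ⟨f, hs ++ [h]⟩) (.loop (F ∪ (hs ++ [h]).toFinset) h)
  /-- There is no member other than `g` left: return `g`. -/
  | finish (F : Finset D[X]) (g : D[X]) (hF : ∀ f ∈ F, f = g) :
      ReduceStep p ν (.loop F g) (.halt g)

/-- States of the main algorithm.  The variable `t` is the loop counter, `S` the current index set,
`ν i` the value of `ν_i` for `i` up to the largest index computed so far (other values are never
read), and `G` the list of columns of the current matrix `G`. -/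
inductive State (D : Type u) [CommRing D] (n : ℕ)
  /-- The head of the main loop, before `t` is incremented. -/
  | head (t : ℕ) (S : Finset ℕ) (ν : ℕ → D[X]) (G : List (Fin 1 ⊕ Fin (n ^ 2) → D[X]))
  /-- `t` has been incremented and `F` has been computed by lifting. -/
  | lifted (t : ℕ) (S : Finset ℕ) (ν : ℕ → D[X]) (G : List (Fin 1 ⊕ Fin (n ^ 2) → D[X]))
      (F : Matrix (Fin 1 ⊕ Fin (n ^ 2)) (Fin (G.length + 1)) D[X])
  /-- The subroutine computing `ν_t` is running. -/
  | computing (t : ℕ) (S : Finset ℕ) (ν : ℕ → D[X]) (G : List (Fin 1 ⊕ Fin (n ^ 2) → D[X]))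
      (c : ReduceState D)
  /-- `ν_t` has been assigned. -/
  | assigned (t : ℕ) (S : Finset ℕ) (ν : ℕ → D[X]) (G : List (Fin 1 ⊕ Fin (n ^ 2) → D[X]))
  /-- The algorithm has returned `S` and the `ν s`, `s ∈ S`. -/
  | halt (S : Finset ℕ) (ν : ℕ → D[X])

/-- The initial state: `t = 0`, `S = ∅`, `ν_0 = 1`, and `G` has no columns. -/
def State.init (D : Type u) [CommRing D] (n : ℕ) : State D n :=
  .head 0 ∅ (fun _ => 1) []

/-- The quotients of the long divisions of the `ν b_i` by the characteristic polynomial `χ_B`,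
where the `b_i` are the entries of `adj (X - B)` in the order `e`. -/
def IsQuotientVector {n : ℕ} (e : Fin (n ^ 2) ≃ Fin n × Fin n) (B : Matrix (Fin n) (Fin n) D)
    (ν : D[X]) (g : Fin (n ^ 2) → D[X]) : Prop :=
  ∀ i, ∃ r : D[X], ν * B.charmatrix.adjugate (e i).1 (e i).2 = g i * B.charpoly + r ∧
    r.degree < B.charpoly.degree

open Classical in
/-- The steps of the main algorithm on input `B` and `p`; `K` is the quotient field, over which the
minimal polynomial of `B` is taken, and `e` is the fixed order of the entries of `adj (X - B)`. -/
inductive Step (K : Type v) [Field K] [Algebra D K] {n : ℕ} (e : Fin (n ^ 2) ≃ Fin n × Fin n)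
    (B : Matrix (Fin n) (Fin n) D) (p : D) : State D n → State D n → Prop
  /-- Increment `t` and compute `F` by lifting. -/
  | lift (t : ℕ) (S : Finset ℕ) (ν : ℕ → D[X]) (G : List (Fin 1 ⊕ Fin (n ^ 2) → D[X]))
      (F : Matrix (Fin 1 ⊕ Fin (n ^ 2)) (Fin (G.length + 1)) D[X])
      (hF : Lifting p t (mcCoyMatrix e B) (ofColumns G) F) :
      Step K e B p (.head t S ν G) (.lifted (t + 1) S ν G F)
  /-- Call the subroutine on the set of entries of the first row of `F`. -/
  | call (t : ℕ) (S : Finset ℕ) (ν : ℕ → D[X]) (G : List (Fin 1 ⊕ Fin (n ^ 2) → D[X]))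
      (F : Matrix (Fin 1 ⊕ Fin (n ^ 2)) (Fin (G.length + 1)) D[X]) :
      Step K e B p (.lifted t S ν G F)
        (.computing t S ν G (.start (Finset.univ.image fun j => F (Sum.inl 0) j)))
  /-- A step of the subroutine, which uses `ν_{t-1}`. -/
  | run (t : ℕ) (S : Finset ℕ) (ν : ℕ → D[X]) (G : List (Fin 1 ⊕ Fin (n ^ 2) → D[X]))
      (c c' : ReduceState D) (hc : ReduceStep p (ν (t - 1)) c c') :
      Step K e B p (.computing t S ν G c) (.computing t S ν G c')
  /-- The subroutine has returned `g`: put `ν_t := g`. -/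
  | assign (t : ℕ) (S : Finset ℕ) (ν : ℕ → D[X]) (G : List (Fin 1 ⊕ Fin (n ^ 2) → D[X]))
      (g : D[X]) :
      Step K e B p (.computing t S ν G (.halt g)) (.assigned t S (Function.update ν t g) G)
  /-- If `deg ν_t ≥ deg μ_B`, return. -/
  | ret (t : ℕ) (S : Finset ℕ) (ν : ℕ → D[X]) (G : List (Fin 1 ⊕ Fin (n ^ 2) → D[X]))
      (hdeg : (minpoly K (B.map (algebraMap D K))).degree ≤ (ν t).degree) :
      Step K e B p (.assigned t S ν G) (.halt S ν)
  /-- If `deg ν_t = deg ν_{t-1}`, delete the last column of `G` and the index `t - 1` before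
  adding the new column and the new index. -/
  | replace (t : ℕ) (S : Finset ℕ) (ν : ℕ → D[X]) (G : List (Fin 1 ⊕ Fin (n ^ 2) → D[X]))
      (a : Fin 1 ⊕ Fin (n ^ 2) → D[X]) (g : Fin (n ^ 2) → D[X])
      (hdeg : (ν t).degree < (minpoly K (B.map (algebraMap D K))).degree)
      (hg : IsQuotientVector e B (ν t) g)
      (heq : (ν t).degree = (ν (t - 1)).degree) :
      Step K e B p (.assigned t S ν (G ++ [a]))
        (.head t (insert t (S.erase (t - 1))) ν
          (G.map (fun a => C p • a) ++ [Sum.elim (fun _ => ν t) g]))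
  /-- Otherwise, add the new column and the new index. -/
  | append (t : ℕ) (S : Finset ℕ) (ν : ℕ → D[X]) (G : List (Fin 1 ⊕ Fin (n ^ 2) → D[X]))
      (g : Fin (n ^ 2) → D[X])
      (hdeg : (ν t).degree < (minpoly K (B.map (algebraMap D K))).degree)
      (hg : IsQuotientVector e B (ν t) g)
      (hne : (ν t).degree ≠ (ν (t - 1)).degree) :
      Step K e B p (.assigned t S ν G)
        (.head t (insert t S) ν
          (G.map (fun a => C p • a) ++ [Sum.elim (fun _ => ν t) g]))

/-- A state that some run of the main algorithm on input `B` and `p` reaches. -/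
def Reachable (K : Type v) [Field K] [Algebra D K] {n : ℕ} (e : Fin (n ^ 2) ≃ Fin n × Fin n)
    (B : Matrix (Fin n) (Fin n) D) (p : D) (c : State D n) : Prop :=
  Relation.ReflTransGen (Step K e B p) (State.init D n) c

/-- The intermediate assertions of the main algorithm.

* At the head of the loop the columns of `(p ^ t I | G)` generate the module of solutions of
  `A f ≡ 0 (mod p ^ t)`, where `A = (b | -χ_B I)`.
* After the lifting the columns of `(p ^ t I | F | p G)` generate the corresponding module.
* The set handed to the subroutine has the `(p ^ t)`-generating property.
* The polynomial `ν_t` is a `(p ^ t)`-minimal polynomial of `B`. -/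
def Assertion {n : ℕ} (e : Fin (n ^ 2) ≃ Fin n × Fin n) (B : Matrix (Fin n) (Fin n) D) (p : D) :
    State D n → Prop
  | .head t _ _ G =>
      ColumnsGenerate
        (Matrix.fromCols
          (C (p ^ t) • (1 : Matrix (Fin 1 ⊕ Fin (n ^ 2)) (Fin 1 ⊕ Fin (n ^ 2)) D[X]))
          (ofColumns G))
        (congruenceModule p t (mcCoyMatrix e B))
  | .lifted t _ _ G F =>
      ColumnsGenerate
        (Matrix.fromCols
          (C (p ^ t) • (1 : Matrix (Fin 1 ⊕ Fin (n ^ 2)) (Fin 1 ⊕ Fin (n ^ 2)) D[X]))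
          (Matrix.fromCols F (C p • ofColumns G)))
        (congruenceModule p t (mcCoyMatrix e B))
  | .computing t _ _ _ (.start F) => HasGeneratingProperty p B t F
  | .computing _ _ _ _ _ => True
  | .assigned t _ ν _ => IsMinimalPoly (Ideal.span {p ^ t}) B (ν t)
  | .halt _ _ => True

end Algorithms

section Structure

variable {D : Type u} [CommRing D]

/-- `b(t) = inf {r ∈ S | r ≥ t}`, which is `∞` if there is no such `r`. -/
def nextIndex (S : Finset ℕ) (t : ℕ) : ℕ∞ :=
  sInf ((fun r : ℕ => (r : ℕ∞)) '' {r : ℕ | r ∈ S ∧ t ≤ r})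

/-- The ideal `p ^ t D[X] + ∑_{s ∈ S, s ≤ b(t)} p ^ max {0, t - s} ν_s D[X]`. -/
def describedIdeal (p : D) (S : Finset ℕ) (ν : ℕ → D[X]) (t : ℕ) : Ideal D[X] :=
  Ideal.span {C (p ^ t)} ⊔
    ⨆ (s : ℕ) (_ : s ∈ S) (_ : (s : ℕ∞) ≤ nextIndex S t), Ideal.span {C (p ^ (t - s)) * ν s}

/-- `S` and the polynomials `ν s`, `s ∈ S`, describe the structure of all `(p ^ t)`-ideals of `B`,
where `μ` is the minimal polynomial of `B`. -/
structure DescribesIdeals {n : ℕ} (B : Matrix (Fin n) (Fin n) D) (p : D) (μ : D[X])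
    (S : Finset ℕ) (ν : ℕ → D[X]) : Prop where
  pos : ∀ s ∈ S, 1 ≤ s
  minimal : ∀ s ∈ S, IsMinimalPoly (Ideal.span {p ^ s}) B (ν s)
  degree_strictMono : ∀ s ∈ S, ∀ s' ∈ S, s < s' → (ν s).degree < (ν s').degree
  nullIdeal_eq : ∀ t : ℕ, 1 ≤ t →
    nullIdealOf (p ^ t) B = Ideal.span {μ} ⊔ describedIdeal p S ν t
  nullIdeal_eq_of_le : ∀ t : ℕ, 1 ≤ t → (t : WithBot ℕ) ≤ S.max →
    nullIdealOf (p ^ t) B = describedIdeal p S ν t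

end Structure

end PMinimal

end

/-!
Write `N t` for the ideal of all `f ∈ D[X]` with `f(B) ≡ 0 (mod p ^ t)`.

**Minimal polynomials.** A polynomial `f ∈ N (t + 1)` that is not divisible by `p` can be replaced by
a monic polynomial of `N (t + 1)` of degree at most `deg f` (`FindMonic.spec`); that this is possible
at all rests on the fact that elements of `N t` of degree less than that of a `p ^ t`-minimal
polynomial are divisible by `p`, and the replacement in turn yields this fact for `t + 1`
(`IsMinimalPoly.dvd_of_degree_lt`). Hence a monic `ν` is `p ^ (t + 1)`-minimal if and only if
`N (t + 1) = (ν) + p N t` (`IsMinimalPoly.nullIdealOf_succ`, `isMinimalPoly_of_nullIdealOf_succ`).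
Unfolding this recursion, with minimal polynomials of equal degree exchanged for the one with the
largest index and with `μ_B` taken from the point where its degree is reached, gives the description
of all `N t` (`describesIdeals`).

**Lifting.** By McCoy's criterion, `N t` consists of the first coordinates of the module `M t` of
solutions of `(b | -χ_B I) f ≡ 0 (mod p ^ t)`
(`mem_nullIdealOf_iff_exists_mem_congruenceModule`). Among the combinations of generators of `M t`,
those in `M (t + 1)` are given by a kernel modulo `p`, which the Smith normal form exhibits
(`Lifting.columnsGenerate`); the existence of that form over the Euclidean domain `(D / p)[X]` is
`exists_smith_normal_form`. As `χ_B` is monic, an element of `M (t + 1)` is determined modulo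
`p ^ (t + 1)` by its first coordinate, so the recursion for `N (t + 1)` shows that a single new
column, with first entry `ν_{t + 1}`, suffices (`columnsGenerate_append`); it makes the preceding
column superfluous if the degree has not grown (`columnsGenerate_replace`).

**Termination.** The replacement procedure stops after one iteration, because its result is
associated to its input modulo `p`. In the reduction, the number of non-monic polynomials, then the
degree of the chosen polynomial, then the number of polynomials decreases (`reduceRank`). The main
loop ends because for `d < deg μ_B` a linear form that vanishes on the powers `B ^ i`, `i < d`, but
not on `B ^ d` bounds the exponents `t` for which `N t` has a monic element of degree `d`
(`exists_bound`).
-/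

namespace PMinimal

universe u v

/-! ### Division by a monic polynomial modulo a constant -/

section Division

variable {R : Type u} [CommRing R]

/-- Uniqueness of division by a monic polynomial, modulo a constant `a`. -/
theorem dvd_of_dvd_mul_monic_add {a : R} {h q r : R[X]} (hh : h.Monic) (hr : r.degree < h.degree)
    (hd : C a ∣ q * h + r) : C a ∣ q ∧ C a ∣ r := by
  nontriviality R
  obtain ⟨s, hs⟩ := hd
  have h1 := div_modByMonic_unique (f := C a * s) q r hh ⟨by rw [← hs]; ring, hr⟩
  have hlt : (C a * (s %ₘ h)).degree < h.degree := by
    rw [← smul_eq_C_mul]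
    exact (degree_smul_le _ _).trans_lt (degree_modByMonic_lt s hh)
  have hE : C a * (s %ₘ h) + h * (C a * (s /ₘ h)) = C a * s := by
    conv_rhs => rw [← modByMonic_add_div s h]
    ring
  have h2 := div_modByMonic_unique (C a * (s /ₘ h)) (C a * (s %ₘ h)) hh ⟨hE, hlt⟩
  exact ⟨⟨_, h1.1.symm.trans h2.1⟩, ⟨_, h1.2.symm.trans h2.2⟩⟩

theorem dvd_of_dvd_mul_monic {a : R} {h q : R[X]} (hh : h.Monic) (hd : C a ∣ q * h) : C a ∣ q := by
  nontriviality R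
  refine (dvd_of_dvd_mul_monic_add (r := 0) hh ?_ (by simpa using hd)).1
  rw [degree_zero, bot_lt_iff_ne_bot, Ne, degree_eq_bot]
  exact hh.ne_zero

theorem not_C_dvd_of_monic {a : R} (ha : ¬ IsUnit a) {h : R[X]} (hh : h.Monic) : ¬ C a ∣ h := by
  intro hd
  have := (C_dvd_iff_dvd_coeff a h).1 hd h.natDegree
  rw [hh.coeff_natDegree] at this
  exact ha (isUnit_of_dvd_one this)

/-- Separating the coefficients that are divisible by `p` from the others. -/
theorem exists_eq_add_C_mul (p : R) (f : R[X]) :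
    ∃ f₁ f₂ : R[X], f = f₁ + C p * f₂ ∧ ∀ i, f₁.coeff i ≠ 0 → ¬ p ∣ f₁.coeff i := by
  classical
  let f₁ : R[X] := ∑ i ∈ f.support with ¬ p ∣ f.coeff i, monomial i (f.coeff i)
  have hc : ∀ i, f₁.coeff i = if p ∣ f.coeff i then 0 else f.coeff i := by
    intro i
    simp only [f₁, finsetSum_coeff, coeff_monomial, Finset.sum_ite_eq', Finset.mem_filter,
      mem_support_iff]
    by_cases h : p ∣ f.coeff i
    · simp [h]
    · have : f.coeff i ≠ 0 := fun h0 => h (h0 ▸ dvd_zero p)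
      simp [h, this]
  have hd : C p ∣ f - f₁ := by
    rw [C_dvd_iff_dvd_coeff]
    intro i
    rw [coeff_sub, hc]
    split_ifs with h
    · simpa using h
    · simp
  obtain ⟨f₂, hf₂⟩ := hd
  refine ⟨f₁, f₂, by rw [← hf₂]; ring, fun i hi => ?_⟩
  rw [hc] at hi ⊢
  split_ifs with h
  · simp [h] at hi
  · exact h

end Division

/-! ### The ideals of polynomials that vanish at a matrix modulo a constant -/

section NullIdeal

variable {R : Type u} [CommRing R] {n : ℕ} {B : Matrix (Fin n) (Fin n) R}

theorem mem_nullIdealOf {a : R} {f : R[X]} :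
    f ∈ nullIdealOf a B ↔ ∀ i j, a ∣ (aeval B f) i j := by
  simp only [nullIdealOf, ← Ideal.mem_span_singleton]
  rfl

theorem nullIdealOf_anti {a b : R} (h : a ∣ b) : nullIdealOf b B ≤ nullIdealOf a B :=
  fun _ hf => mem_nullIdealOf.2 fun i j => h.trans (mem_nullIdealOf.1 hf i j)

theorem nullIdealOf_pow_anti (p : R) {s t : ℕ} (h : s ≤ t) :
    nullIdealOf (p ^ t) B ≤ nullIdealOf (p ^ s) B :=
  nullIdealOf_anti (pow_dvd_pow p h)

theorem C_mul_mem_nullIdealOf {a b : R} {f : R[X]} (hf : f ∈ nullIdealOf b B) :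
    C a * f ∈ nullIdealOf (a * b) B := by
  rw [mem_nullIdealOf] at hf ⊢
  intro i j
  rw [← smul_eq_C_mul, map_smul, Matrix.smul_apply, smul_eq_mul]
  exact mul_dvd_mul_left a (hf i j)

theorem C_mul_mem_nullIdealOf_succ {p : R} {t : ℕ} {f : R[X]} (hf : f ∈ nullIdealOf (p ^ t) B) :
    C p * f ∈ nullIdealOf (p ^ (t + 1)) B := by
  rw [pow_succ']
  exact C_mul_mem_nullIdealOf hf

theorem mem_of_C_mul_mem_nullIdealOf_succ [IsDomain R] {p : R} (hp : p ≠ 0) {t : ℕ} {f : R[X]}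
    (hf : C p * f ∈ nullIdealOf (p ^ (t + 1)) B) : f ∈ nullIdealOf (p ^ t) B := by
  rw [mem_nullIdealOf] at hf ⊢
  intro i j
  have := hf i j
  rwa [← smul_eq_C_mul, map_smul, Matrix.smul_apply, smul_eq_mul, pow_succ',
    mul_dvd_mul_iff_left hp] at this

theorem C_mul_nullIdealOf_le (p : R) (t : ℕ) :
    Ideal.span {C p} * nullIdealOf (p ^ t) B ≤ nullIdealOf (p ^ (t + 1)) B := by
  intro f hf
  obtain ⟨g, hg, rfl⟩ := Ideal.mem_span_singleton_mul.1 hf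
  exact C_mul_mem_nullIdealOf_succ hg

theorem mem_C_mul_nullIdealOf_of_dvd [IsDomain R] {p : R} (hp : p ≠ 0) {t : ℕ} {f : R[X]}
    (hf : f ∈ nullIdealOf (p ^ (t + 1)) B) (hd : C p ∣ f) :
    f ∈ Ideal.span {C p} * nullIdealOf (p ^ t) B := by
  obtain ⟨g, rfl⟩ := hd
  exact Ideal.mem_span_singleton_mul.2 ⟨g, mem_of_C_mul_mem_nullIdealOf_succ hp hf, rfl⟩

theorem mem_nullIdealOf_of_aeval_eq_zero (a : R) {f : R[X]} (hf : aeval B f = 0) :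
    f ∈ nullIdealOf a B :=
  mem_nullIdealOf.2 fun i j => by simp [hf]

theorem charpoly_mem_nullIdealOf (a : R) : B.charpoly ∈ nullIdealOf a B :=
  mem_nullIdealOf_of_aeval_eq_zero a (Matrix.aeval_self_charpoly B)

theorem nullIdealOf_one : nullIdealOf (1 : R) B = ⊤ := by
  rw [Ideal.eq_top_iff_one]
  exact mem_nullIdealOf.2 fun _ _ => one_dvd _

theorem isMinimalPoly_iff {a : R} {ν : R[X]} :
    IsMinimalPoly (Ideal.span {a}) B ν ↔ ν.Monic ∧ ν ∈ nullIdealOf a B ∧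
      ∀ g : R[X], g.Monic → g ∈ nullIdealOf a B → ν.degree ≤ g.degree := Iff.rfl

theorem exists_isMinimalPoly (a : R) (B : Matrix (Fin n) (Fin n) R) :
    ∃ ν, IsMinimalPoly (Ideal.span {a}) B ν := by
  obtain ⟨ν, hν, hmin⟩ := WellFounded.has_min (measure fun f : R[X] => f.natDegree).wf
    {f | f.Monic ∧ f ∈ nullIdealOf a B} ⟨_, B.charpoly_monic, charpoly_mem_nullIdealOf a⟩
  refine ⟨ν, hν.1, hν.2, fun g hg hgm => ?_⟩
  nontriviality R
  rw [degree_eq_natDegree hν.1.ne_zero, degree_eq_natDegree hg.ne_zero, Nat.cast_le]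
  exact not_lt.1 (hmin g ⟨hg, hgm⟩)

theorem isMinimalPoly_one : IsMinimalPoly (Ideal.span {(1 : R)}) B 1 := by
  refine isMinimalPoly_iff.2 ⟨monic_one, by simp [nullIdealOf_one], fun g hg _ => ?_⟩
  rcases subsingleton_or_nontrivial R with _ | _
  · rw [Subsingleton.elim g 1]
  rw [degree_one]
  exact zero_le_degree_iff.2 hg.ne_zero

/-- The degrees of the `p ^ t`-minimal polynomials increase with `t`. -/
theorem IsMinimalPoly.degree_le {p : R} {s t : ℕ} {ν ν' : R[X]}
    (h : IsMinimalPoly (Ideal.span {p ^ s}) B ν) (h' : IsMinimalPoly (Ideal.span {p ^ t}) B ν')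
    (hst : s ≤ t) : ν.degree ≤ ν'.degree :=
  h.2.2 ν' h'.1 (nullIdealOf_pow_anti p hst h'.2.1)

/-- Over a smaller ideal, a monic polynomial of the same degree is again minimal. -/
theorem IsMinimalPoly.of_degree_eq {p : R} {s t : ℕ} {ν ν' : R[X]}
    (h : IsMinimalPoly (Ideal.span {p ^ s}) B ν) (hm : ν'.Monic)
    (hν' : ν' ∈ nullIdealOf (p ^ t) B)
    (hst : s ≤ t) (hd : ν'.degree ≤ ν.degree) : IsMinimalPoly (Ideal.span {p ^ s}) B ν' :=
  ⟨hm, nullIdealOf_pow_anti p hst hν', fun g hg hgm => hd.trans (h.2.2 g hg hgm)⟩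

/-- A monic polynomial `ν` with `N (t + 1) = (ν) + p N t`, where `N t` is the `p ^ t`-ideal of `B`, is
minimal. -/
theorem isMinimalPoly_of_nullIdealOf_succ {p : R} (hp : ¬ IsUnit p) {t : ℕ} {ν : R[X]} (hν : ν.Monic)
    (h : nullIdealOf (p ^ (t + 1)) B =
      Ideal.span {ν} ⊔ Ideal.span {C p} * nullIdealOf (p ^ t) B) :
    IsMinimalPoly (Ideal.span {p ^ (t + 1)}) B ν := by
  refine isMinimalPoly_iff.2 ⟨hν, ?_, fun f hf hfm => ?_⟩
  · rw [h]
    exact Ideal.mem_sup_left (Ideal.mem_span_singleton_self ν)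
  · rw [h] at hfm
    obtain ⟨x, hx, y, hy, rfl⟩ := Submodule.mem_sup.1 hfm
    obtain ⟨a, rfl⟩ := Ideal.mem_span_singleton'.1 hx
    obtain ⟨b, -, rfl⟩ := Ideal.mem_span_singleton_mul.1 hy
    by_contra! hlt
    exact not_C_dvd_of_monic hp hf
      (dvd_of_dvd_mul_monic_add (q := -a) hν hlt ⟨b, by ring⟩).2

end NullIdeal

/-! ### Replacing a polynomial by a monic one -/

section FindMonic

variable {D : Type u} [CommRing D] [IsDomain D]
  {n : ℕ} {B : Matrix (Fin n) (Fin n) D} {p : D}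

/-- Whatever is chosen, the replacement `h` of `f` is monic, lies in the same ideal, is at most as
large in degree, and is associated to `f` modulo `p`. -/
theorem FindMonic.spec {t : ℕ} {ν f h : D[X]} (hνm : ν.Monic)
    (hν : ν ∈ nullIdealOf (p ^ t) B) (hf : f ∈ nullIdealOf (p ^ (t + 1)) B) (hpf : ¬ C p ∣ f)
    (H : FindMonic p ν f h) :
    h.Monic ∧ h ∈ nullIdealOf (p ^ (t + 1)) B ∧ h.natDegree ≤ f.natDegree ∧
      ∃ w, C p ∣ f - C w * h := by
  obtain ⟨f₁, f₂, q, r, u, v, k, hff, hf₁, hf₂, hr, huv, hk, rfl⟩ := H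
  have hf₁0 : f₁ ≠ 0 := by
    rintro rfl
    exact hpf ⟨f₂, by rw [hff]; ring⟩
  have hlc : ¬ p ∣ f₁.leadingCoeff := hf₁ _ (by simpa using hf₁0)
  have hle : f₁.natDegree ≤ f.natDegree := by
    refine le_natDegree_of_ne_zero fun h0 => hlc ?_
    rw [hff, coeff_add, coeff_C_mul] at h0
    exact ⟨-f₂.coeff f₁.natDegree, by rw [leadingCoeff]; linear_combination h0⟩
  have hrd : r.degree < (f₁.natDegree : WithBot ℕ) := by
    refine hr.trans_le ?_
    rw [degree_eq_natDegree hνm.ne_zero, ← hk]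
    exact_mod_cast Nat.le_add_right _ _
  have hnd : (C u * (f₁ + C p * r) + C v * X ^ k * (C p * ν)).natDegree ≤ f₁.natDegree := by
    refine natDegree_add_le_of_degree_le ?_ ?_
    · refine (natDegree_C_mul_le _ _).trans (natDegree_add_le_of_degree_le le_rfl ?_)
      exact (natDegree_C_mul_le _ _).trans (natDegree_le_iff_degree_le.2 hrd.le)
    · rw [mul_assoc]
      refine (natDegree_C_mul_le _ _).trans (natDegree_mul_le.trans ?_)
      have := natDegree_C_mul_le p ν
      rw [natDegree_X_pow]
      omega
  have hcoeff : (C u * (f₁ + C p * r) + C v * X ^ k * (C p * ν)).coeff f₁.natDegree = 1 := by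
    have h1 : C v * X ^ k * (C p * ν) = C (v * p) * (ν * X ^ k) := by
      rw [C_mul]; ring
    rw [h1, coeff_add, coeff_C_mul, coeff_C_mul, coeff_add, coeff_C_mul,
      coeff_eq_zero_of_degree_lt hrd, ← hk, coeff_mul_X_pow, hνm.coeff_natDegree, hk]
    rw [leadingCoeff] at huv
    linear_combination huv
  have hmem : f₁ + C p * r ∈ nullIdealOf (p ^ (t + 1)) B := by
    have : f₁ + C p * r = f - q * (C p * ν) := by rw [hff, hf₂]; ring
    rw [this]
    exact sub_mem hf (Ideal.mul_mem_left _ _ (C_mul_mem_nullIdealOf_succ hν))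
  refine ⟨monic_of_natDegree_le_of_coeff_eq_one _ hnd hcoeff,
    add_mem (Ideal.mul_mem_left _ _ hmem)
      (Ideal.mul_mem_left _ _ (C_mul_mem_nullIdealOf_succ hν)), hnd.trans hle, f₁.leadingCoeff, ?_⟩
  refine ⟨f₂ + C v * f₁ - C f₁.leadingCoeff * (C u * r + C v * X ^ k * ν), ?_⟩
  have huv' : C u * C f₁.leadingCoeff + C v * C p = 1 := by
    rw [← C_mul, ← C_mul, ← C_add, huv, C_1]
  rw [hff]
  linear_combination (-f₁) * huv'

variable [IsPrincipalIdealRing D]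

theorem FindMonic.exists_of_degree (hp : Prime p) {t : ℕ} {ν f : D[X]} (hνm : ν.Monic)
    (hν : ν ∈ nullIdealOf (p ^ t) B)
    (hmin : ∀ f ∈ nullIdealOf (p ^ t) B, f.degree < ν.degree → C p ∣ f)
    (hf : f ∈ nullIdealOf (p ^ (t + 1)) B) (hpf : ¬ C p ∣ f) :
    ∃ h, FindMonic p ν f h := by
  obtain ⟨f₁, f₂, hff, hf₁⟩ := exists_eq_add_C_mul p f
  have hf₁0 : f₁ ≠ 0 := by
    rintro rfl
    exact hpf ⟨f₂, by rw [hff]; ring⟩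
  have hlc : ¬ p ∣ f₁.leadingCoeff := hf₁ _ (by simpa using hf₁0)
  obtain ⟨v, u, huv⟩ := (hp.irreducible.coprime_iff_not_dvd).2 hlc
  have hdiv := modByMonic_add_div f₂ ν
  have hr := degree_modByMonic_lt f₂ hνm
  have hdeg : ν.natDegree ≤ f₁.natDegree := by
    by_contra! hlt
    have hlt' : f₁.degree < ν.degree := degree_lt_degree hlt
    -- a summand of `f` of small degree would lie in the ideal of the previous exponent
    have hmem : f₁ + C p * (f₂ %ₘ ν) ∈ nullIdealOf (p ^ t) B := by
      have : f₁ + C p * (f₂ %ₘ ν) = f - (f₂ /ₘ ν) * (C p * ν) := by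
        rw [hff]; linear_combination C p * hdiv
      rw [this]
      exact sub_mem (nullIdealOf_pow_anti p t.le_succ hf)
        (Ideal.mul_mem_left _ _ (Ideal.mul_mem_left _ _ hν))
    have hd : C p ∣ f₁ := by
      refine (dvd_add_left (dvd_mul_right (C p) (f₂ %ₘ ν))).1 (hmin _ hmem ?_)
      refine (degree_add_le _ _).trans_lt (max_lt hlt' ?_)
      rw [← smul_eq_C_mul]
      exact (degree_smul_le _ _).trans_lt hr
    exact hlc ((C_dvd_iff_dvd_coeff p f₁).1 hd _)
  exact ⟨_, f₁, f₂, f₂ /ₘ ν, f₂ %ₘ ν, u, v, f₁.natDegree - ν.natDegree, hff, hf₁,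
    by linear_combination -hdiv, hr, by linear_combination huv, by omega, rfl⟩

/-- A polynomial of the `p ^ t`-ideal whose degree is smaller than that of a minimal polynomial is
divisible by `p`: otherwise it could be replaced by a monic one. -/
theorem IsMinimalPoly.dvd_of_degree_lt (hp : Prime p) {t : ℕ} {ν : D[X]}
    (hν : IsMinimalPoly (Ideal.span {p ^ t}) B ν) :
    ∀ f ∈ nullIdealOf (p ^ t) B, f.degree < ν.degree → C p ∣ f := by
  induction t generalizing ν with
  | zero =>
    intro f _ hd
    have h1 : ν.degree ≤ (1 : D[X]).degree :=
      hν.2.2 1 monic_one (by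
        change _ ∈ nullIdealOf (p ^ 0) B
        simp [nullIdealOf_one])
    rw [degree_one] at h1
    have : f = 0 := by
      rw [← degree_eq_bot]
      exact Nat.WithBot.lt_zero_iff.1 (hd.trans_le h1)
    simp [this]
  | succ t ih =>
    intro f hf hd
    by_contra hpf
    obtain ⟨ν', hν'⟩ := exists_isMinimalPoly (p ^ t) B
    obtain ⟨h, hh⟩ := FindMonic.exists_of_degree hp hν'.1 hν'.2.1 (ih hν') hf hpf
    obtain ⟨hm, hmem, hle, -⟩ := hh.spec hν'.1 hν'.2.1 hf hpf
    have hf0 : f ≠ 0 := fun h0 => hpf (h0 ▸ dvd_zero _)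
    refine not_le.2 hd ((hν.2.2 h hm hmem).trans ?_)
    rw [degree_eq_natDegree hm.ne_zero, degree_eq_natDegree hf0]
    exact_mod_cast hle

theorem FindMonic.exists_of_isMinimalPoly (hp : Prime p) {t : ℕ} {ν f : D[X]}
    (hν : IsMinimalPoly (Ideal.span {p ^ t}) B ν)
    (hf : f ∈ nullIdealOf (p ^ (t + 1)) B) (hpf : ¬ C p ∣ f) :
    ∃ h, FindMonic p ν f h :=
  FindMonic.exists_of_degree hp hν.1 hν.2.1 (hν.dvd_of_degree_lt hp) hf hpf

/-- A minimal polynomial `ν` satisfies the recursion `N (t + 1) = (ν) + p N t` for the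
`p ^ t`-ideals `N t` of `B`. -/
theorem IsMinimalPoly.nullIdealOf_succ (hp : Prime p) {t : ℕ} {ν : D[X]}
    (hν : IsMinimalPoly (Ideal.span {p ^ (t + 1)}) B ν) :
    nullIdealOf (p ^ (t + 1)) B =
      Ideal.span {ν} ⊔ Ideal.span {C p} * nullIdealOf (p ^ t) B := by
  refine le_antisymm (fun f hf => ?_) (sup_le ?_ (C_mul_nullIdealOf_le p t))
  · have hr : f %ₘ ν ∈ nullIdealOf (p ^ (t + 1)) B := by
      rw [modByMonic_eq_sub_mul_div]
      exact sub_mem hf (Ideal.mul_mem_right _ _ hν.2.1)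
    have hd := hν.dvd_of_degree_lt hp _ hr (degree_modByMonic_lt f hν.1)
    rw [← modByMonic_add_div f ν, add_comm]
    exact Submodule.add_mem_sup (Ideal.mul_mem_right _ _ (Ideal.mem_span_singleton_self ν))
      (mem_C_mul_nullIdealOf_of_dvd hp.ne_zero hr hd)
  · rw [Ideal.span_le, Set.singleton_subset_iff]
    exact hν.2.1

end FindMonic

/-! ### Membership in the null ideals and the adjugate of `X - B` -/

section McCoy

variable {R : Type u} [CommRing R] {n : ℕ} {B : Matrix (Fin n) (Fin n) R}

theorem exists_smul_one_sub_aeval_eq_mul_charmatrix (B : Matrix (Fin n) (Fin n) R) (f : R[X]) :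
    ∃ Q : Matrix (Fin n) (Fin n) R[X],
      f • (1 : Matrix (Fin n) (Fin n) R[X]) - (aeval B f).map C = Q * B.charmatrix := by
  have hX : (X : R[X]) • (1 : Matrix (Fin n) (Fin n) R[X]) = B.charmatrix + B.map C := by
    rw [Matrix.charmatrix, Matrix.smul_one_eq_diagonal]
    simp [Matrix.scalar_apply, RingHom.mapMatrix_apply]
  induction f using Polynomial.induction_on' with
  | add f g hf hg =>
    obtain ⟨P, hP⟩ := hf
    obtain ⟨Q, hQ⟩ := hg
    refine ⟨P + Q, ?_⟩
    rw [add_mul, ← hP, ← hQ, map_add, add_smul, Matrix.map_add _ (fun _ _ => C_add)]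
    abel
  | monomial k a =>
    induction k with
    | zero =>
      refine ⟨0, ?_⟩
      ext i j
      by_cases hij : i = j <;>
        simp [Matrix.algebraMap_matrix_apply, hij]
    | succ k ih =>
      obtain ⟨Q, hQ⟩ := ih
      refine ⟨(X : R[X]) • Q + (aeval B (monomial k a : R[X])).map C, ?_⟩
      have h1 : (monomial (k + 1) a : R[X]) = X * monomial k a := (X_mul_monomial k a).symm
      have h2 : (aeval B (X * monomial k a : R[X])).map C
          = (aeval B (monomial k a : R[X])).map C * B.map C := by
        rw [mul_comm X, map_mul, aeval_X, Matrix.map_mul]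
      have h3 : (aeval B (monomial k a : R[X])).map C * ((X : R[X]) • (1 : Matrix (Fin n) (Fin n) R[X]))
          = (X : R[X]) • (aeval B (monomial k a : R[X])).map C := by simp
      rw [h1, h2, add_mul, Matrix.smul_mul, ← hQ, mul_smul, smul_sub, ← h3, hX, mul_add]
      abel

theorem mcCoyMatrix_mulVec (e : Fin (n ^ 2) ≃ Fin n × Fin n) (B : Matrix (Fin n) (Fin n) R)
    (f : Fin 1 ⊕ Fin (n ^ 2) → R[X]) (i : Fin (n ^ 2)) :
    (mcCoyMatrix e B).mulVec f i =
      f (Sum.inl 0) * B.charmatrix.adjugate (e i).1 (e i).2 - f (Sum.inr i) * B.charpoly := by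
  rw [mcCoyMatrix, Matrix.fromCols_mulVec, Pi.add_apply, Matrix.neg_mulVec, Matrix.smul_mulVec,
    Matrix.one_mulVec]
  simp [Matrix.mulVec, dotProduct]
  ring

/-- **McCoy's criterion**: `f(B) ≡ 0 (mod a)` if and only if `χ_B` divides all entries of
`f adj (X - B)` modulo `a`. -/
theorem mem_nullIdealOf_iff_exists (e : Fin (n ^ 2) ≃ Fin n × Fin n) {a : R} {f : R[X]} :
    f ∈ nullIdealOf a B ↔
      ∃ g : Fin (n ^ 2) → R[X],
        ∀ i, C a ∣ f * B.charmatrix.adjugate (e i).1 (e i).2 - g i * B.charpoly := by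
  have hadj : B.charmatrix * B.charmatrix.adjugate = B.charpoly • 1 :=
    Matrix.mul_adjugate _
  have hadj' : B.charmatrix.adjugate * B.charmatrix = B.charpoly • 1 :=
    Matrix.adjugate_mul _
  constructor
  · intro hf
    rw [mem_nullIdealOf] at hf
    obtain ⟨Q, hQ⟩ := exists_smul_one_sub_aeval_eq_mul_charmatrix B f
    choose M hM using hf
    refine ⟨fun i => Q (e i).1 (e i).2, fun i => ?_⟩
    have hMB : (aeval B f).map C = C a • Matrix.of fun i j => C (M i j) := by
      ext1 i j
      simp [hM i j]
    have key : f • B.charmatrix.adjugate - B.charpoly • Q =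
        C a • ((Matrix.of fun i j => C (M i j)) * B.charmatrix.adjugate) := by
      have := congrArg (· * B.charmatrix.adjugate) hQ
      simp only [sub_mul, Matrix.smul_mul, one_mul, mul_assoc, hadj, hMB, Matrix.mul_smul,
        mul_one] at this
      rw [← this]
      abel
    have := congrFun (congrFun key (e i).1) (e i).2
    simp only [Matrix.sub_apply, Matrix.smul_apply, smul_eq_mul] at this
    exact ⟨_, by rw [← this]; ring⟩
  · rintro ⟨g, hg⟩
    choose H hH using hg
    let G : Matrix (Fin n) (Fin n) R[X] := Matrix.of fun i j => g (e.symm (i, j))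
    let H' : Matrix (Fin n) (Fin n) R[X] := Matrix.of fun i j => H (e.symm (i, j))
    have h1 : f • B.charmatrix.adjugate = B.charpoly • G + C a • H' := by
      ext1 i j
      have := hH (e.symm (i, j))
      simp only [Equiv.apply_symm_apply] at this
      simp only [Matrix.add_apply, Matrix.smul_apply, smul_eq_mul, G, H', Matrix.of_apply]
      linear_combination this
    have h2 : B.charpoly • (f • (1 : Matrix (Fin n) (Fin n) R[X]) - G * B.charmatrix)
        = C a • (H' * B.charmatrix) := by
      have := congrArg (· * B.charmatrix) h1
      simp only [add_mul, Matrix.smul_mul, hadj'] at this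
      rw [smul_sub, smul_comm, this]
      abel
    have h3 : ∀ i j, C a ∣ (f • (1 : Matrix (Fin n) (Fin n) R[X]) - G * B.charmatrix) i j := by
      intro i j
      refine dvd_of_dvd_mul_monic B.charpoly_monic
        ⟨(H' * B.charmatrix) i j, ?_⟩
      have := congrFun (congrFun h2 i) j
      rw [Matrix.smul_apply, Matrix.smul_apply, smul_eq_mul, smul_eq_mul] at this
      rw [← this, mul_comm]
    choose W hW using h3
    have h4 : f • (1 : Matrix (Fin n) (Fin n) R[X]) - G * B.charmatrix
        = (C a • (1 : Matrix (Fin n) (Fin n) R[X])) * Matrix.of W := by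
      rw [Matrix.smul_mul, one_mul]
      ext1 i j
      rw [hW, Matrix.smul_apply, smul_eq_mul, Matrix.of_apply]
    -- evaluation at `B` of the corresponding polynomials with matrix coefficients
    have h5 := congrArg (fun M => (matPolyEquiv M).eval B) h4
    simp only [map_sub, map_mul, matPolyEquiv_smul_one, Matrix.matPolyEquiv_charmatrix, eval_sub,
      eval_mul_X_sub_C, sub_zero, map_C, eval_C_mul] at h5
    rw [eval_map_algebraMap] at h5
    rw [mem_nullIdealOf]
    intro i j
    rw [h5, Algebra.algebraMap_eq_smul_one, Matrix.smul_mul, one_mul, Matrix.smul_apply,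
      smul_eq_mul]
    exact dvd_mul_right _ _

theorem mem_congruenceModule_mcCoyMatrix {e : Fin (n ^ 2) ≃ Fin n × Fin n} {p : R} {t : ℕ}
    {f : Fin 1 ⊕ Fin (n ^ 2) → R[X]} :
    f ∈ congruenceModule p t (mcCoyMatrix e B) ↔ ∀ i, C (p ^ t) ∣
      f (Sum.inl 0) * B.charmatrix.adjugate (e i).1 (e i).2 - f (Sum.inr i) * B.charpoly := by
  simp only [← mcCoyMatrix_mulVec]
  rfl

/-- The `p ^ t`-ideal consists of the first coordinates of the solutions of the congruence. -/
theorem mem_nullIdealOf_iff_exists_mem_congruenceModule (e : Fin (n ^ 2) ≃ Fin n × Fin n) {p : R}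
    {t : ℕ} {f : R[X]} :
    f ∈ nullIdealOf (p ^ t) B ↔
      ∃ x ∈ congruenceModule p t (mcCoyMatrix e B), x (Sum.inl 0) = f := by
  rw [mem_nullIdealOf_iff_exists e]
  constructor
  · rintro ⟨g, hg⟩
    exact ⟨Sum.elim (fun _ => f) g, mem_congruenceModule_mcCoyMatrix.2 hg, rfl⟩
  · rintro ⟨x, hx, rfl⟩
    exact ⟨x ∘ Sum.inr, mem_congruenceModule_mcCoyMatrix.1 hx⟩

end McCoy

/-! ### The Smith normal form over a polynomial ring over a field -/

section Smith

variable {F : Type u} [Field F]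

theorem isUnit_swap (R : Type*) [CommRing R] {ι : Type*} [Fintype ι] [DecidableEq ι] (a b : ι) :
    IsUnit (Matrix.swap R a b) :=
  IsUnit.of_mul_eq_one _ (Matrix.swap_mul_self a b)

/-- If the nonzero entry `d` in the upper left corner has minimal degree among all nonzero entries
of matrices equivalent to `M`, then it divides its row. -/
theorem dvd_row_of_minimal {ι κ : Type*} [Fintype ι] [Fintype κ] [DecidableEq ι] [DecidableEq κ]
    {M : Matrix ι κ F[X]} {i : ι} {j : κ} (h0 : M i j ≠ 0)
    (hmin : ∀ (P : Matrix ι ι F[X]) (Q : Matrix κ κ F[X]), IsUnit P → IsUnit Q → ∀ i' j',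
      (P * M * Q) i' j' ≠ 0 → (M i j).degree ≤ ((P * M * Q) i' j').degree) (j' : κ) :
    M i j ∣ M i j' := by
  by_cases hj : j = j'
  · rw [hj]
  rw [← EuclideanDomain.mod_eq_zero]
  by_contra hne
  -- subtracting a multiple of column `j` from column `j'` leaves the remainder
  have hU : IsUnit (Matrix.transvection j j' (-(M i j' / M i j))) := by
    rw [Matrix.isUnit_iff_isUnit_det, Matrix.det_transvection_of_ne _ _ hj]
    exact isUnit_one
  have hE : ((1 : Matrix ι ι F[X]) * M * Matrix.transvection j j' (-(M i j' / M i j))) i j' = M i j' % M i j := by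
    rw [Matrix.one_mul, Matrix.mul_transvection_apply_same, EuclideanDomain.mod_eq_sub_mul_div]
    ring
  have := hmin 1 _ isUnit_one hU i j' (by rwa [hE])
  rw [hE] at this
  exact not_lt.2 this (EuclideanDomain.mod_lt _ h0)

theorem dvd_col_of_minimal {ι κ : Type*} [Fintype ι] [Fintype κ] [DecidableEq ι] [DecidableEq κ]
    {M : Matrix ι κ F[X]} {i : ι} {j : κ} (h0 : M i j ≠ 0)
    (hmin : ∀ (P : Matrix ι ι F[X]) (Q : Matrix κ κ F[X]), IsUnit P → IsUnit Q → ∀ i' j',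
      (P * M * Q) i' j' ≠ 0 → (M i j).degree ≤ ((P * M * Q) i' j').degree) (i' : ι) :
    M i j ∣ M i' j := by
  refine dvd_row_of_minimal (M := M.transpose) (i := j) (j := i) h0 (fun P Q hP hQ a b hab => ?_) i'
  have hE' : P * M.transpose * Q = (Q.transpose * M * P.transpose).transpose := by
    simp [Matrix.transpose_mul, Matrix.mul_assoc]
  have hE : (P * M.transpose * Q) a b = (Q.transpose * M * P.transpose) b a := by
    rw [hE', Matrix.transpose_apply]
  rw [hE] at hab ⊢
  exact hmin _ _ ((Matrix.isUnit_transpose _).2 hQ) ((Matrix.isUnit_transpose _).2 hP) _ _ hab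

/-- A matrix is equivalent to one with a corner `d` that divides all entries, and with zeros in the
rest of the row and the column of `d`. -/
theorem exists_equiv_fromBlocks {ι κ : Type*} [Fintype ι] [Fintype κ] [DecidableEq ι]
    [DecidableEq κ] (M : Matrix (Unit ⊕ ι) (Unit ⊕ κ) F[X]) :
    ∃ (P : Matrix (Unit ⊕ ι) (Unit ⊕ ι) F[X]) (Q : Matrix (Unit ⊕ κ) (Unit ⊕ κ) F[X])
      (d : F[X]) (N : Matrix ι κ F[X]), IsUnit P ∧ IsUnit Q ∧ (∀ i j, d ∣ N i j) ∧
      P * M * Q = Matrix.fromBlocks (Matrix.of fun _ _ => d) 0 0 N := by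
  by_cases hM : M = 0
  · refine ⟨1, 1, 0, 0, isUnit_one, isUnit_one, fun _ _ => dvd_zero _, ?_⟩
    ext (i | i) (j | j) <;> simp [hM]
  have hne : ∃ i j, M i j ≠ 0 := by
    by_contra! h
    exact hM (Matrix.ext h)
  obtain ⟨i₀, j₀, h₀⟩ := hne
  -- an entry of minimal degree of the matrices equivalent to `M`
  obtain ⟨⟨P, Q, i, j⟩, ⟨hP, hQ, h0⟩, hmin⟩ := WellFounded.has_min
    (measure fun x : Matrix (Unit ⊕ ι) (Unit ⊕ ι) F[X] × Matrix (Unit ⊕ κ) (Unit ⊕ κ) F[X] ×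
      (Unit ⊕ ι) × (Unit ⊕ κ) => ((x.1 * M * x.2.1) x.2.2.1 x.2.2.2).natDegree).wf
    {x | IsUnit x.1 ∧ IsUnit x.2.1 ∧ (x.1 * M * x.2.1) x.2.2.1 x.2.2.2 ≠ 0}
    ⟨⟨1, 1, i₀, j₀⟩, isUnit_one, isUnit_one, by simpa using h₀⟩
  dsimp only at hP hQ h0
  have hmin' : ∀ (P' : Matrix (Unit ⊕ ι) (Unit ⊕ ι) F[X]) (Q' : Matrix (Unit ⊕ κ) (Unit ⊕ κ) F[X]),
      IsUnit P' → IsUnit Q' → ∀ i' j', (P' * M * Q') i' j' ≠ 0 →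
        ((P * M * Q) i j).degree ≤ ((P' * M * Q') i' j').degree := by
    intro P' Q' hP' hQ' i' j' h'
    rw [degree_eq_natDegree h0, degree_eq_natDegree h', Nat.cast_le]
    exact not_lt.1 (hmin ⟨P', Q', i', j'⟩ ⟨hP', hQ', h'⟩)
  clear hmin
  -- move it to the corner
  set M₁ : Matrix (Unit ⊕ ι) (Unit ⊕ κ) F[X] :=
    (Matrix.swap F[X] (Sum.inl ()) i * P) * M * (Q * Matrix.swap F[X] (Sum.inl ()) j) with hM₁
  have hP₁ : IsUnit (Matrix.swap F[X] (Sum.inl ()) i * P) := (isUnit_swap _ _ _).mul hP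
  have hQ₁ : IsUnit (Q * Matrix.swap F[X] (Sum.inl ()) j) := hQ.mul (isUnit_swap _ _ _)
  have hd : M₁ (Sum.inl ()) (Sum.inl ()) = (P * M * Q) i j := by
    have : M₁ = Matrix.swap F[X] (Sum.inl ()) i * (P * M * Q) * Matrix.swap F[X] (Sum.inl ()) j := by
      simp only [hM₁, Matrix.mul_assoc]
    rw [this, Matrix.mul_swap_apply_left, Matrix.swap_mul_apply_left]
  generalize hdd : (P * M * Q) i j = d at *
  have hmin₁ : ∀ (P' : Matrix (Unit ⊕ ι) (Unit ⊕ ι) F[X])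
      (Q' : Matrix (Unit ⊕ κ) (Unit ⊕ κ) F[X]), IsUnit P' → IsUnit Q' → ∀ i' j',
      (P' * M₁ * Q') i' j' ≠ 0 → d.degree ≤ ((P' * M₁ * Q') i' j').degree := by
    intro P' Q' hP' hQ' i' j' h'
    have hE : P' * M₁ * Q' = (P' * (Matrix.swap F[X] (Sum.inl ()) i * P)) * M *
        ((Q * Matrix.swap F[X] (Sum.inl ()) j) * Q') := by
      simp only [hM₁, Matrix.mul_assoc]
    rw [hE] at h' ⊢
    exact hmin' _ _ (hP'.mul hP₁) (hQ₁.mul hQ') _ _ h'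
  have hrow : ∀ j', d ∣ M₁ (Sum.inl ()) j' := by
    intro j'
    rw [← hd]
    exact dvd_row_of_minimal (by rwa [hd]) (by rwa [hd]) j'
  have hcol : ∀ i', d ∣ M₁ i' (Sum.inl ()) := by
    intro i'
    rw [← hd]
    exact dvd_col_of_minimal (by rwa [hd]) (by rwa [hd]) i'
  choose r hr using hrow
  choose c hc using hcol
  -- clear the row and the column of the corner
  let P₂ : Matrix (Unit ⊕ ι) (Unit ⊕ ι) F[X] :=
    Matrix.fromBlocks 1 0 (Matrix.of fun a _ => -c (Sum.inr a)) 1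
  let Q₂ : Matrix (Unit ⊕ κ) (Unit ⊕ κ) F[X] :=
    Matrix.fromBlocks 1 (Matrix.of fun _ b => -r (Sum.inr b)) 0 1
  have hP₂ : IsUnit P₂ := by
    rw [Matrix.isUnit_iff_isUnit_det, Matrix.det_fromBlocks_zero₁₂]
    simp
  have hQ₂ : IsUnit Q₂ := by
    rw [Matrix.isUnit_iff_isUnit_det, Matrix.det_fromBlocks_zero₂₁]
    simp
  let N : Matrix ι κ F[X] := Matrix.of fun a b =>
    M₁ (Sum.inr a) (Sum.inr b) - d * c (Sum.inr a) * r (Sum.inr b)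
  have hblocks : P₂ * M₁ * Q₂ = Matrix.fromBlocks (Matrix.of fun _ _ => d) 0 0 N := by
    have hM₁' : M₁ = Matrix.fromBlocks (Matrix.of fun _ _ => d)
        (Matrix.of fun _ b => d * r (Sum.inr b)) (Matrix.of fun a _ => d * c (Sum.inr a))
        (Matrix.of fun a b => M₁ (Sum.inr a) (Sum.inr b)) := by
      ext1 (a | a) (b | b)
      · exact hd
      · exact hr _
      · exact hc _
      · rfl
    rw [hM₁', Matrix.fromBlocks_multiply, Matrix.fromBlocks_multiply]
    congr 1 <;> ext1 a b <;> simp [Matrix.mul_apply, N] <;> ring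
  have hmin₂ : ∀ (P' : Matrix (Unit ⊕ ι) (Unit ⊕ ι) F[X])
      (Q' : Matrix (Unit ⊕ κ) (Unit ⊕ κ) F[X]), IsUnit P' → IsUnit Q' → ∀ i' j',
      (P' * (P₂ * M₁ * Q₂) * Q') i' j' ≠ 0 →
        d.degree ≤ ((P' * (P₂ * M₁ * Q₂) * Q') i' j').degree := by
    intro P' Q' hP' hQ' i' j' h'
    have hE : P' * (P₂ * M₁ * Q₂) * Q' = (P' * P₂) * M₁ * (Q₂ * Q') := by
      simp only [Matrix.mul_assoc]
    rw [hE] at h' ⊢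
    exact hmin₁ _ _ (hP'.mul hP₂) (hQ₂.mul hQ') _ _ h'
  refine ⟨P₂ * (Matrix.swap F[X] (Sum.inl ()) i * P), (Q * Matrix.swap F[X] (Sum.inl ()) j) * Q₂,
    d, N, hP₂.mul hP₁, hQ₁.mul hQ₂, fun a b => ?_, ?_⟩
  · -- adding row `a` to the row of the corner keeps the corner and moves the entry into its row
    have hU : IsUnit (Matrix.transvection (Sum.inl () : Unit ⊕ ι) (Sum.inr a) (1 : F[X])) := by
      rw [Matrix.isUnit_iff_isUnit_det, Matrix.det_transvection_of_ne _ _ (by simp)]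
      exact isUnit_one
    have hc3 : (Matrix.transvection (Sum.inl () : Unit ⊕ ι) (Sum.inr a) (1 : F[X]) *
        (P₂ * M₁ * Q₂)) (Sum.inl ()) (Sum.inl ()) = d := by
      rw [Matrix.transvection_mul_apply_same, hblocks]
      simp
    have := dvd_row_of_minimal (i := Sum.inl ()) (j := Sum.inl ())
      (M := Matrix.transvection (Sum.inl () : Unit ⊕ ι) (Sum.inr a) (1 : F[X]) * (P₂ * M₁ * Q₂))
      (by rwa [hc3]) (by
        rw [hc3]
        intro P' Q' hP' hQ' i' j' h'
        rw [← Matrix.mul_assoc] at h' ⊢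
        exact hmin₂ _ _ (hP'.mul hU) hQ' _ _ h') (Sum.inr b)
    rw [hc3, Matrix.transvection_mul_apply_same, hblocks] at this
    simpa using this
  · rw [← hblocks]
    simp only [hM₁, Matrix.mul_assoc]

/-- **Smith normal form** of a matrix with at least as many columns as rows. -/
theorem exists_smith_normal_form (c e : ℕ) (M : Matrix (Fin c) (Fin c ⊕ Fin e) F[X]) :
    ∃ (P : Matrix (Fin c) (Fin c) F[X]) (Q : Matrix (Fin c ⊕ Fin e) (Fin c ⊕ Fin e) F[X])
      (α : Fin c → F[X]), IsUnit P ∧ IsUnit Q ∧ (∀ i j, i ≤ j → α i ∣ α j) ∧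
      P * M * Q = Matrix.fromCols (Matrix.diagonal α) 0 := by
  induction c with
  | zero => exact ⟨1, 1, 0, isUnit_one, isUnit_one, fun i => i.elim0, Matrix.ext fun i => i.elim0⟩
  | succ c ih =>
    let σ : Fin (c + 1) ≃ Unit ⊕ Fin c :=
      { toFun := Fin.cases (Sum.inl ()) Sum.inr
        invFun := Sum.elim (fun _ => 0) Fin.succ
        left_inv := fun i => by cases i using Fin.cases <;> rfl
        right_inv := fun i => by rcases i with _ | _ <;> rfl }
    let τ : Fin (c + 1) ⊕ Fin e ≃ Unit ⊕ (Fin c ⊕ Fin e) :=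
      (Equiv.sumCongr σ (Equiv.refl _)).trans (Equiv.sumAssoc _ _ _)
    obtain ⟨P₁, Q₁, d, N, hP₁, hQ₁, hd, hPQ₁⟩ :=
      exists_equiv_fromBlocks (M.submatrix σ.symm τ.symm)
    obtain ⟨P₂, Q₂, α, hP₂, hQ₂, hα, hPQ₂⟩ := ih N
    have hdα : ∀ i, d ∣ α i := by
      intro i
      have : α i = (P₂ * N * Q₂) i (Sum.inl i) := by rw [hPQ₂]; simp
      rw [this, Matrix.mul_apply]
      refine Finset.dvd_sum fun k _ => Dvd.dvd.mul_right ?_ _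
      rw [Matrix.mul_apply]
      exact Finset.dvd_sum fun l _ => (hd l k).mul_left _
    let P₃ : Matrix (Unit ⊕ Fin c) (Unit ⊕ Fin c) F[X] := Matrix.fromBlocks 1 0 0 P₂
    let Q₃ : Matrix (Unit ⊕ (Fin c ⊕ Fin e)) (Unit ⊕ (Fin c ⊕ Fin e)) F[X] :=
      Matrix.fromBlocks 1 0 0 Q₂
    have hP₃ : IsUnit (P₃ * P₁) := by
      refine IsUnit.mul ?_ hP₁
      rw [Matrix.isUnit_iff_isUnit_det, Matrix.det_fromBlocks_zero₁₂, Matrix.det_one, one_mul]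
      exact (Matrix.isUnit_iff_isUnit_det _).1 hP₂
    have hQ₃ : IsUnit (Q₁ * Q₃) := by
      refine IsUnit.mul hQ₁ ?_
      rw [Matrix.isUnit_iff_isUnit_det, Matrix.det_fromBlocks_zero₁₂, Matrix.det_one, one_mul]
      exact (Matrix.isUnit_iff_isUnit_det _).1 hQ₂
    have hblocks : (P₃ * P₁) * M.submatrix σ.symm τ.symm * (Q₁ * Q₃) =
        Matrix.fromBlocks (Matrix.of fun _ _ => d) 0 0 (Matrix.fromCols (Matrix.diagonal α) 0) := by
      have : (P₃ * P₁) * M.submatrix σ.symm τ.symm * (Q₁ * Q₃) =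
          P₃ * (P₁ * M.submatrix σ.symm τ.symm * Q₁) * Q₃ := by simp only [Matrix.mul_assoc]
      rw [this, hPQ₁, Matrix.fromBlocks_multiply, Matrix.fromBlocks_multiply]
      simp [hPQ₂]
    refine ⟨(P₃ * P₁).submatrix σ σ, (Q₁ * Q₃).submatrix τ τ, Fin.cons d α,
      (Matrix.isUnit_submatrix_equiv σ σ).2 hP₃, (Matrix.isUnit_submatrix_equiv τ τ).2 hQ₃, ?_, ?_⟩
    · intro i j hij
      induction i using Fin.cases with
      | zero =>
        induction j using Fin.cases with
        | zero => exact dvd_rfl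
        | succ j => simpa using hdα j
      | succ i =>
        induction j using Fin.cases with
        | zero => simp at hij
        | succ j => simpa using hα i j (by simpa using hij)
    · have hM : M = (M.submatrix σ.symm τ.symm).submatrix σ τ := by
        ext1 i j; simp
      rw [hM, Matrix.submatrix_mul_equiv, Matrix.submatrix_mul_equiv, hblocks]
      ext1 i j
      induction i using Fin.cases with
      | zero =>
        rcases j with j | j
        · induction j using Fin.cases with
          | zero => simp [σ, τ]
          | succ j => simp [σ, τ, (Fin.succ_ne_zero j).symm]
        · simp [σ, τ]
      | succ i =>
        rcases j with j | j
        · induction j using Fin.cases with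
          | zero => simp [σ, τ]
          | succ j => simp [σ, τ, Matrix.diagonal_apply]
        · simp [σ, τ]

end Smith

/-! ### Modules generated by columns -/

section Columns

variable {R : Type u} [CommRing R]

theorem columnsGenerate_iff {δ γ : Type*} [Fintype γ] {M : Matrix δ γ R[X]}
    {N : Submodule R[X] (δ → R[X])} :
    ColumnsGenerate M N ↔ ∀ f, f ∈ N ↔ ∃ z, M.mulVec z = f := by
  have h : Submodule.span R[X] (Set.range fun j i => M i j) = LinearMap.range M.mulVecLin :=
    (Matrix.range_mulVecLin M).symm
  rw [ColumnsGenerate, h, eq_comm, SetLike.ext_iff]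
  rfl

theorem columnsGenerate_ofColumns_iff {δ : Type*} [Fintype δ] [DecidableEq δ] {a : R}
    {G : List (δ → R[X])} {N : Submodule R[X] (δ → R[X])} :
    ColumnsGenerate (Matrix.fromCols (C a • (1 : Matrix δ δ R[X])) (ofColumns G)) N ↔
      ∀ f, f ∈ N ↔ ∃ x, f - C a • x ∈ Submodule.span R[X] {y | y ∈ G} := by
  have hG : Submodule.span R[X] {y | y ∈ G} = LinearMap.range (ofColumns G).mulVecLin := by
    rw [Matrix.range_mulVecLin]
    congr 1
    ext y
    rw [Set.mem_ofPred_eq, List.mem_iff_get]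
    rfl
  rw [columnsGenerate_iff, hG]
  refine forall_congr' fun f => iff_congr Iff.rfl ?_
  simp only [LinearMap.mem_range, Matrix.mulVecLin_apply]
  constructor
  · rintro ⟨z, rfl⟩
    refine ⟨z ∘ Sum.inl, z ∘ Sum.inr, ?_⟩
    rw [Matrix.fromCols_mulVec, Matrix.smul_mulVec, Matrix.one_mulVec]
    abel
  · rintro ⟨x, y, hy⟩
    refine ⟨Sum.elim x y, ?_⟩
    rw [Matrix.fromCols_mulVec_sumElim, Matrix.smul_mulVec, Matrix.one_mulVec, hy]
    abel

variable {κ δ : Type*} [Fintype δ] {p : R} {t : ℕ} {A : Matrix κ δ R[X]}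

theorem mem_congruenceModule {f : δ → R[X]} :
    f ∈ congruenceModule p t A ↔ ∀ i, C (p ^ t) ∣ A.mulVec f i := Iff.rfl

theorem C_smul_mem_congruenceModule_succ {f : δ → R[X]} (hf : f ∈ congruenceModule p t A) :
    C p • f ∈ congruenceModule p (t + 1) A := by
  intro i
  rw [Matrix.mulVec_smul, Pi.smul_apply, smul_eq_mul, pow_succ', C_mul]
  exact mul_dvd_mul_left _ (hf i)

theorem C_pow_smul_mem_congruenceModule (f : δ → R[X]) :
    C (p ^ t) • f ∈ congruenceModule p t A := by
  intro i
  rw [Matrix.mulVec_smul, Pi.smul_apply, smul_eq_mul]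
  exact dvd_mul_right _ _

theorem congruenceModule_succ_le : congruenceModule p (t + 1) A ≤ congruenceModule p t A :=
  fun _ hf i => ((_root_.map_dvd C (pow_dvd_pow p t.le_succ))).trans (hf i)

end Columns

/-! ### Lifting -/

section Lifting

variable {D : Type u} [CommRing D] {p : D}

theorem map_mk_eq_zero_iff {f : D[X]} :
    f.map (Ideal.Quotient.mk (Ideal.span {p})) = 0 ↔ C p ∣ f := by
  rw [C_dvd_iff_dvd_coeff, Polynomial.ext_iff]
  simp only [coeff_map, coeff_zero, Ideal.Quotient.eq_zero_iff_mem, Ideal.mem_span_singleton]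

theorem reduceMod_mulVec {κ δ : Type*} [Fintype δ] (M : Matrix κ δ D[X]) (z : δ → D[X]) :
    (reduceMod p M).mulVec (fun k => (z k).map (Ideal.Quotient.mk (Ideal.span {p}))) =
      fun i => (M.mulVec z i).map (Ideal.Quotient.mk (Ideal.span {p})) := by
  ext1 i
  simp [reduceMod, Matrix.mulVec, dotProduct, Polynomial.map_sum]

theorem exists_reduceMod_eq {κ δ : Type*} (M : Matrix κ δ (D ⧸ Ideal.span {p})[X]) :
    ∃ N, reduceMod p N = M := by
  choose f hf using Polynomial.map_surjective _ (Ideal.Quotient.mk_surjective (I := Ideal.span {p}))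
  exact ⟨M.map f, Matrix.ext fun i j => hf _⟩

/-- The lifting step can be carried out, whatever solutions modulo `p ^ t` it is given. -/
theorem exists_lifting [IsDomain D] [IsPrincipalIdealRing D] (hp : Prime p) {δ : Type} [Fintype δ]
    [DecidableEq δ] {c s e : ℕ} (σ : δ ⊕ Fin s ≃ Fin c ⊕ Fin e) {t : ℕ}
    (A : Matrix (Fin c) δ D[X]) (G : Matrix δ (Fin s) D[X])
    (hG : ∀ j, (fun i => G i j) ∈ congruenceModule p t A) :
    ∃ F : Matrix δ (Fin e) D[X], Lifting p t A G F := by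
  have hmax : (Ideal.span {p}).IsMaximal :=
    PrincipalIdealRing.isMaximal_of_irreducible hp.irreducible
  choose R hR using fun i j => hG j i
  let _ := Ideal.Quotient.field (Ideal.span {p})
  obtain ⟨P, Q, α, hP, hQ, hα, hPQ⟩ := exists_smith_normal_form c e
    ((reduceMod p (Matrix.fromCols A (Matrix.of R))).submatrix id σ.symm)
  obtain ⟨S, hS⟩ := exists_reduceMod_eq P
  obtain ⟨T, hT⟩ := exists_reduceMod_eq (Q.submatrix σ id)
  obtain ⟨Q', hQ₁, hQ₂⟩ := isUnit_iff_exists.1 hQ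
  refine ⟨_, Matrix.of R, S, T, Q'.submatrix id σ, α, ?_, ?_, ?_, ?_, hα, ?_, rfl⟩
  · ext1 i j
    exact (hR i j).symm
  · rw [hS]; exact hP
  · rw [hT]
    refine (Matrix.submatrix_mul_equiv Q Q' σ (Equiv.refl _) σ).trans ?_
    rw [hQ₁]
    exact Matrix.submatrix_one_equiv σ
  · rw [hT]
    refine (Matrix.submatrix_mul_equiv Q' Q id σ id).trans ?_
    rw [hQ₂, Matrix.submatrix_id_id]
  · rw [hS, hT, Matrix.mul_assoc, ← hPQ, Matrix.mul_assoc]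
    congr 1
    conv_rhs => rw [← Matrix.submatrix_id_id (_ * Q), ← Matrix.submatrix_mul_equiv _ Q id σ id,
      Matrix.submatrix_submatrix]
    simp

/-- **Correctness of lifting.** The independence of the rows of `A` modulo `p` forces all invariant
factors `α i` to be nonzero, so that the last columns of `T` span the kernel of `(A | R)`
modulo `p`. -/
theorem Lifting.columnsGenerate [IsDomain D] (hp : Prime p) {δ : Type} [Fintype δ]
    [DecidableEq δ] {c s e : ℕ} {t : ℕ}
    {A : Matrix (Fin c) δ D[X]} {G : Matrix δ (Fin s) D[X]} {F : Matrix δ (Fin e) D[X]}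
    (hA : ∀ v, Matrix.vecMul v (reduceMod p A) = 0 → v = 0)
    (hG : ColumnsGenerate (Matrix.fromCols (C (p ^ t) • (1 : Matrix δ δ D[X])) G)
      (congruenceModule p t A))
    (hF : Lifting p t A G F) :
    ColumnsGenerate (Matrix.fromCols (C (p ^ (t + 1)) • (1 : Matrix δ δ D[X]))
      (Matrix.fromCols F (C p • G))) (congruenceModule p (t + 1) A) := by
  obtain ⟨R, S, T, T', α, hR, hS, hTT', hTT, -, hdiag, rfl⟩ := hF
  have hprime : (Ideal.span {p}).IsPrime := (Ideal.span_singleton_prime hp.ne_zero).2 hp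
  rw [columnsGenerate_iff] at hG ⊢
  set U := Matrix.fromCols (C (p ^ t) • (1 : Matrix δ δ D[X])) G with hU
  have hAU : ∀ z, A.mulVec (U.mulVec z) = C (p ^ t) • (Matrix.fromCols A R).mulVec z := by
    intro z
    rw [Matrix.mulVec_mulVec, ← Matrix.smul_mulVec]
    congr 1
    rw [hU, Matrix.mul_fromCols, ← hR, Matrix.mul_smul, Matrix.mul_one]
    ext1 i (j | j) <;> rfl
  have hpt : C (p ^ t) ≠ (0 : D[X]) := by
    rw [Ne, C_eq_zero]
    exact pow_ne_zero _ hp.ne_zero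
  have hU1 : ∀ z, U.mulVec z ∈ congruenceModule p (t + 1) A ↔
      ∀ i, C p ∣ (Matrix.fromCols A R).mulVec z i := by
    intro z
    rw [mem_congruenceModule, hAU]
    refine forall_congr' fun i => ?_
    rw [Pi.smul_apply, smul_eq_mul, pow_succ, C_mul, mul_dvd_mul_iff_left hpt]
  have hα : ∀ i, α i ≠ 0 := by
    intro i hi
    have h1 : reduceMod p S * reduceMod p (Matrix.fromCols A R) =
        (Matrix.fromCols (Matrix.diagonal α) 0 : Matrix (Fin c) (Fin c ⊕ Fin e) _) * T' := by
      rw [← hdiag, Matrix.mul_assoc (_ * _) (reduceMod p T) T', hTT', Matrix.mul_one]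
    have h2 : Matrix.vecMul (reduceMod p S i) (reduceMod p (Matrix.fromCols A R)) = 0 := by
      have h3 := congrFun h1 i
      rw [Matrix.mul_apply_eq_vecMul, Matrix.mul_apply_eq_vecMul] at h3
      rw [h3]
      have h4 : (Matrix.fromCols (Matrix.diagonal α)
          (0 : Matrix (Fin c) (Fin e) (D ⧸ Ideal.span {p})[X])) i = 0 := by
        ext1 (j | j)
        · by_cases hij : i = j <;> simp [hij, ← hi]
        · rfl
      rw [h4, Matrix.zero_vecMul]
    have h5 : reduceMod p S i = 0 := by
      refine hA _ ?_
      ext1 j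
      exact congrFun h2 (Sum.inl j)
    obtain ⟨S', hS'⟩ := hS.exists_right_inv
    have h6 := congrFun (congrFun hS' i) i
    rw [Matrix.mul_apply_eq_vecMul, h5, Matrix.zero_vecMul, Matrix.one_apply_eq] at h6
    exact zero_ne_one h6
  have hTF : ∀ w, (U * T).toCols₂.mulVec w = U.mulVec (T.mulVec (Sum.elim 0 w)) := by
    intro w
    rw [Matrix.mulVec_mulVec]
    conv_rhs => rw [← Matrix.fromCols_toCols (U * T)]
    rw [Matrix.fromCols_mulVec_sumElim, Matrix.mulVec_zero, zero_add]
  intro f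
  constructor
  · intro hf
    obtain ⟨z, rfl⟩ := (hG f).1 (congruenceModule_succ_le hf)
    rw [hU1] at hf
    set z' := fun k => (z k).map (Ideal.Quotient.mk (Ideal.span {p})) with hz'
    have h1 : (reduceMod p (Matrix.fromCols A R)).mulVec z' = 0 := by
      rw [reduceMod_mulVec]
      ext1 i
      exact map_mk_eq_zero_iff.2 (hf i)
    set w := T'.mulVec z' with hw
    have h2 : (reduceMod p T).mulVec w = z' := by
      rw [hw, Matrix.mulVec_mulVec, hTT', Matrix.one_mulVec]
    have h3 : w ∘ Sum.inl = 0 := by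
      have h4 : (Matrix.fromCols (Matrix.diagonal α) 0).mulVec w = 0 := by
        rw [← hdiag, ← Matrix.mulVec_mulVec, h2, ← Matrix.mulVec_mulVec, h1, Matrix.mulVec_zero]
      rw [Matrix.fromCols_mulVec, Matrix.zero_mulVec, add_zero] at h4
      ext1 i
      have := congrFun h4 i
      rw [Matrix.mulVec_diagonal] at this
      exact (mul_eq_zero.1 this).resolve_left (hα i)
    choose l hl using
      Polynomial.map_surjective _ (Ideal.Quotient.mk_surjective (I := Ideal.span {p}))
    have h4 : ∀ k, C p ∣ z k - T.mulVec (Sum.elim 0 (fun j => l (w (Sum.inr j)))) k := by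
      intro k
      rw [← map_mk_eq_zero_iff, Polynomial.map_sub, sub_eq_zero]
      have h5 := congrFun (reduceMod_mulVec (p := p) T
        (Sum.elim 0 (fun j => l (w (Sum.inr j))))) k
      rw [← h5]
      have h6 : (fun k => (Sum.elim (0 : Fin c → D[X]) (fun j => l (w (Sum.inr j))) k).map
          (Ideal.Quotient.mk (Ideal.span {p}))) = w := by
        ext1 (j | j)
        · simpa using (congrFun h3 j).symm
        · exact hl _
      rw [h6, h2]
    choose y hy using h4
    refine ⟨Sum.elim (y ∘ Sum.inl) (Sum.elim (fun j => l (w (Sum.inr j))) (y ∘ Sum.inr)), ?_⟩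
    have hz : z = T.mulVec (Sum.elim 0 (fun j => l (w (Sum.inr j)))) + C p • y := by
      ext1 k
      rw [Pi.add_apply, Pi.smul_apply, smul_eq_mul, ← hy]
      ring
    rw [Matrix.fromCols_mulVec_sumElim, Matrix.fromCols_mulVec_sumElim, hTF]
    have hUy : U.mulVec y = C (p ^ t) • (y ∘ Sum.inl) + G.mulVec (y ∘ Sum.inr) := by
      rw [hU, Matrix.fromCols_mulVec, Matrix.smul_mulVec, Matrix.one_mulVec]
    conv_rhs => rw [hz, Matrix.mulVec_add, Matrix.mulVec_smul, hUy]
    rw [pow_succ', C_mul, mul_smul, Matrix.smul_mulVec, Matrix.smul_mulVec, Matrix.smul_mulVec,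
      Matrix.one_mulVec, smul_add]
    abel
  · rintro ⟨z, rfl⟩
    rw [Matrix.fromCols_mulVec, Matrix.fromCols_mulVec, hTF]
    refine add_mem ?_ (add_mem ?_ ?_)
    · rw [Matrix.smul_mulVec]
      exact C_pow_smul_mem_congruenceModule _
    · rw [hU1]
      set w := (z ∘ Sum.inr) ∘ Sum.inl
      obtain ⟨S', hS'⟩ := hS.exists_left_inv
      have h1 : (reduceMod p (Matrix.fromCols A R)).mulVec ((reduceMod p T).mulVec
          (fun k => ((Sum.elim 0 w : Fin c ⊕ Fin e → D[X]) k).map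
            (Ideal.Quotient.mk (Ideal.span {p})))) = 0 := by
        have h2 : ∀ v, (reduceMod p (Matrix.fromCols A R)).mulVec ((reduceMod p T).mulVec v) =
            S'.mulVec ((Matrix.fromCols (Matrix.diagonal α) 0).mulVec v) := by
          intro v
          rw [← hdiag, Matrix.mulVec_mulVec, Matrix.mulVec_mulVec, ← Matrix.mul_assoc,
            ← Matrix.mul_assoc, hS', Matrix.one_mul]
        rw [h2, Matrix.fromCols_mulVec]
        have : (fun k => ((Sum.elim 0 w : Fin c ⊕ Fin e → D[X]) k).map
            (Ideal.Quotient.mk (Ideal.span {p}))) ∘ Sum.inl = 0 := by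
          ext1 j; simp
        rw [this, Matrix.mulVec_zero, Matrix.zero_mulVec, add_zero, Matrix.mulVec_zero]
      rw [reduceMod_mulVec, reduceMod_mulVec] at h1
      exact fun i => map_mk_eq_zero_iff.1 (congrFun h1 i)
    · rw [Matrix.smul_mulVec]
      refine C_smul_mem_congruenceModule_succ ((hG _).2 ⟨Sum.elim 0 ((z ∘ Sum.inr) ∘ Sum.inr), ?_⟩)
      rw [hU, Matrix.fromCols_mulVec_sumElim, Matrix.mulVec_zero, zero_add]

variable {n : ℕ} {B : Matrix (Fin n) (Fin n) D}

/-- As `χ_B` is monic, the rows of `(b | -χ_B I)` are independent modulo `p`. -/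
theorem eq_zero_of_vecMul_reduceMod_mcCoyMatrix (e : Fin (n ^ 2) ≃ Fin n × Fin n)
    (v : Fin (n ^ 2) → (D ⧸ Ideal.span {p})[X])
    (hv : Matrix.vecMul v (reduceMod p (mcCoyMatrix e B)) = 0) : v = 0 := by
  have hm : (B.charpoly.map (Ideal.Quotient.mk (Ideal.span {p}))).Monic := B.charpoly_monic.map _
  ext1 i
  have h1 := congrFun hv (Sum.inr i)
  have h2 : Matrix.vecMul v (reduceMod p (mcCoyMatrix e B)) (Sum.inr i) =
      -(v i * B.charpoly.map (Ideal.Quotient.mk (Ideal.span {p}))) := by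
    rw [Matrix.vecMul, dotProduct, Finset.sum_eq_single i]
    · simp [reduceMod, mcCoyMatrix]
    · intro j _ hj
      simp [reduceMod, mcCoyMatrix, hj]
    · simp
  rw [h2, Pi.zero_apply, neg_eq_zero] at h1
  exact hm.isRegular.right (by simpa using h1)

/-- The set handed to the reduction has the generating property. -/
theorem hasGeneratingProperty_of_columnsGenerate (e : Fin (n ^ 2) ≃ Fin n × Fin n) {t s r : ℕ}
    {G : Matrix (Fin 1 ⊕ Fin (n ^ 2)) (Fin s) D[X]} {F : Matrix (Fin 1 ⊕ Fin (n ^ 2)) (Fin r) D[X]}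
    (hG : ColumnsGenerate (Matrix.fromCols
      (C (p ^ t) • (1 : Matrix (Fin 1 ⊕ Fin (n ^ 2)) (Fin 1 ⊕ Fin (n ^ 2)) D[X])) G)
      (congruenceModule p t (mcCoyMatrix e B)))
    (hF : ColumnsGenerate (Matrix.fromCols
      (C (p ^ (t + 1)) • (1 : Matrix (Fin 1 ⊕ Fin (n ^ 2)) (Fin 1 ⊕ Fin (n ^ 2)) D[X]))
      (Matrix.fromCols F (C p • G))) (congruenceModule p (t + 1) (mcCoyMatrix e B))) :
    HasGeneratingProperty p B (t + 1) (Set.range fun j => F (Sum.inl 0) j) := by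
  rw [columnsGenerate_iff] at hG hF
  rw [HasGeneratingProperty, Nat.add_sub_cancel]
  refine le_antisymm (fun f hf => ?_) (sup_le ?_ (C_mul_nullIdealOf_le p t))
  · obtain ⟨x, hx, rfl⟩ := (mem_nullIdealOf_iff_exists_mem_congruenceModule e).1 hf
    obtain ⟨z, rfl⟩ := (hF x).1 hx
    have hE : Matrix.mulVec (Matrix.fromCols
        (C (p ^ (t + 1)) • (1 : Matrix (Fin 1 ⊕ Fin (n ^ 2)) (Fin 1 ⊕ Fin (n ^ 2)) D[X]))
        (Matrix.fromCols F (C p • G))) z =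
        F.mulVec ((z ∘ Sum.inr) ∘ Sum.inl) + C p • Matrix.mulVec (Matrix.fromCols
        (C (p ^ t) • (1 : Matrix (Fin 1 ⊕ Fin (n ^ 2)) (Fin 1 ⊕ Fin (n ^ 2)) D[X])) G)
        (Sum.elim (z ∘ Sum.inl) ((z ∘ Sum.inr) ∘ Sum.inr)) := by
      rw [Matrix.fromCols_mulVec, Matrix.fromCols_mulVec, Matrix.fromCols_mulVec_sumElim,
        pow_succ' p t, C_mul, mul_smul, Matrix.smul_mulVec, Matrix.smul_mulVec,
        Matrix.smul_mulVec, smul_add]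
      abel
    rw [hE]
    refine Submodule.add_mem_sup ?_ (Ideal.mem_span_singleton_mul.2 ⟨_,
      (mem_nullIdealOf_iff_exists_mem_congruenceModule e).2 ⟨_, (hG _).2 ⟨_, rfl⟩, rfl⟩, rfl⟩)
    change ∑ j, F (Sum.inl 0) j * z (Sum.inr (Sum.inl j)) ∈ _
    exact Ideal.sum_mem _ fun j _ =>
      Ideal.mul_mem_right _ _ (Ideal.subset_span (Set.mem_range_self j))
  · rw [Ideal.span_le]
    rintro _ ⟨j, rfl⟩
    refine (mem_nullIdealOf_iff_exists_mem_congruenceModule e).2 ⟨fun i => F i j, (hF _).2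
      ⟨Sum.elim 0 (Sum.elim (Pi.single j 1) 0), ?_⟩, rfl⟩
    rw [Matrix.fromCols_mulVec_sumElim, Matrix.fromCols_mulVec_sumElim, Matrix.mulVec_zero,
      Matrix.mulVec_zero, zero_add, add_zero, Matrix.mulVec_single_one]
    rfl

end Lifting

/-! ### Updating the generators -/

section Update

variable {D : Type u} [CommRing D] {p : D} {n : ℕ} {B : Matrix (Fin n) (Fin n) D}
  {e : Fin (n ^ 2) ≃ Fin n × Fin n}

theorem exists_isQuotientVector (e : Fin (n ^ 2) ≃ Fin n × Fin n) (B : Matrix (Fin n) (Fin n) D)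
    (ν : D[X]) [Nontrivial D] : ∃ g, IsQuotientVector e B ν g :=
  ⟨fun i => (ν * B.charmatrix.adjugate (e i).1 (e i).2) /ₘ B.charpoly, fun i =>
    ⟨(ν * B.charmatrix.adjugate (e i).1 (e i).2) %ₘ B.charpoly, by
      conv_lhs => rw [← modByMonic_add_div (ν * _) B.charpoly]
      ring, degree_modByMonic_lt _ B.charpoly_monic⟩⟩

/-- The remainders of the divisions by `χ_B` vanish modulo `p ^ t`. -/
theorem IsQuotientVector.mem_congruenceModule {t : ℕ} {ν : D[X]} {g : Fin (n ^ 2) → D[X]}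
    (hg : IsQuotientVector e B ν g) (hν : ν ∈ nullIdealOf (p ^ t) B) :
    Sum.elim (fun _ => ν) g ∈ congruenceModule p t (mcCoyMatrix e B) := by
  rw [mem_congruenceModule_mcCoyMatrix]
  intro i
  obtain ⟨q, hq⟩ := (mem_nullIdealOf_iff_exists e).1 hν
  obtain ⟨r, hE, hr⟩ := hg i
  have h1 : C (p ^ t) ∣ (g i - q i) * B.charpoly + r := by
    convert hq i using 1
    linear_combination -hE
  convert (dvd_of_dvd_mul_monic_add B.charpoly_monic hr h1).2 using 1
  simp only [Sum.elim_inl, Sum.elim_inr]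
  linear_combination hE

theorem C_smul_mem_span_map {δ : Type*} {G : List (δ → D[X])} {y : δ → D[X]}
    (hy : y ∈ Submodule.span D[X] {y | y ∈ G}) :
    C p • y ∈ Submodule.span D[X] {y | y ∈ G.map fun a => C p • a} := by
  induction hy using Submodule.span_induction with
  | mem y hy => exact Submodule.subset_span (List.mem_map_of_mem hy)
  | zero => rw [smul_zero]; exact zero_mem _
  | add x y _ _ hx hy => rw [smul_add]; exact add_mem hx hy
  | smul a x _ hx => rw [smul_comm]; exact Submodule.smul_mem _ a hx

variable [IsDomain D] [IsPrincipalIdealRing D]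

theorem columnsGenerate_append (hp : Prime p) {t : ℕ} {G : List (Fin 1 ⊕ Fin (n ^ 2) → D[X])}
    {ν : D[X]} {g : Fin (n ^ 2) → D[X]}
    (hG : ColumnsGenerate (Matrix.fromCols
      (C (p ^ t) • (1 : Matrix (Fin 1 ⊕ Fin (n ^ 2)) (Fin 1 ⊕ Fin (n ^ 2)) D[X])) (ofColumns G))
      (congruenceModule p t (mcCoyMatrix e B)))
    (hν : IsMinimalPoly (Ideal.span {p ^ (t + 1)}) B ν) (hg : IsQuotientVector e B ν g) :
    ColumnsGenerate (Matrix.fromCols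
      (C (p ^ (t + 1)) • (1 : Matrix (Fin 1 ⊕ Fin (n ^ 2)) (Fin 1 ⊕ Fin (n ^ 2)) D[X]))
      (ofColumns (G.map (fun a => C p • a) ++ [Sum.elim (fun _ => ν) g])))
      (congruenceModule p (t + 1) (mcCoyMatrix e B)) := by
  rw [columnsGenerate_ofColumns_iff] at hG ⊢
  have ha := hg.mem_congruenceModule (e := e) hν.2.1
  intro f
  constructor
  · intro hf
    have h0 := (mem_nullIdealOf_iff_exists_mem_congruenceModule e).2 ⟨f, hf, rfl⟩
    rw [hν.nullIdealOf_succ hp] at h0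
    obtain ⟨_, h1, _, h2, h12⟩ := Submodule.mem_sup.1 h0
    obtain ⟨h, rfl⟩ := Ideal.mem_span_singleton'.1 h1
    obtain ⟨f', hf', rfl⟩ := Ideal.mem_span_singleton_mul.1 h2
    obtain ⟨y, hy, rfl⟩ := (mem_nullIdealOf_iff_exists_mem_congruenceModule e).1 hf'
    obtain ⟨x, hx⟩ := (hG y).1 hy
    -- what remains has first coordinate zero, hence is divisible by `p ^ (t + 1)`
    have hrest : f - h • Sum.elim (fun _ => ν) g - C p • y ∈
        congruenceModule p (t + 1) (mcCoyMatrix e B) :=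
      sub_mem (sub_mem hf (Submodule.smul_mem _ h ha)) (C_smul_mem_congruenceModule_succ hy)
    have hrest0 : (f - h • Sum.elim (fun _ => ν) g - C p • y : Fin 1 ⊕ Fin (n ^ 2) → D[X])
        (Sum.inl 0) = 0 := by
      simp only [Pi.sub_apply, Pi.smul_apply, Sum.elim_inl, smul_eq_mul, ← h12]
      ring
    have hdvd : ∀ k, C (p ^ (t + 1)) ∣
        (f - h • Sum.elim (fun _ => ν) g - C p • y : Fin 1 ⊕ Fin (n ^ 2) → D[X]) k := by
      rintro (k | k)
      · rw [Subsingleton.elim k 0, hrest0]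
        exact dvd_zero _
      · have := mem_congruenceModule_mcCoyMatrix.1 hrest k
        rw [hrest0, zero_mul, zero_sub, dvd_neg] at this
        exact dvd_of_dvd_mul_monic B.charpoly_monic this
    choose x' hx' using hdvd
    refine ⟨x + x', ?_⟩
    have hE : f - C (p ^ (t + 1)) • (x + x') =
        h • Sum.elim (fun _ => ν) g + C p • (y - C (p ^ t) • x) := by
      have hfun : f - h • Sum.elim (fun _ => ν) g - C p • y = C (p ^ (t + 1)) • x' :=
        funext hx'
      rw [smul_add, ← hfun, pow_succ' p t, C_mul, mul_smul, smul_sub]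
      abel
    rw [hE]
    refine add_mem (Submodule.smul_mem _ h (Submodule.subset_span (by simp))) ?_
    exact Submodule.span_mono (fun z hz => List.mem_append_left _ hz) (C_smul_mem_span_map hx)
  · rintro ⟨x, hx⟩
    rw [← sub_add_cancel f (C (p ^ (t + 1)) • x)]
    refine add_mem ?_ (C_pow_smul_mem_congruenceModule x)
    refine (Submodule.span_le.2 ?_ : Submodule.span D[X] _ ≤ _) hx
    intro z hz
    rcases List.mem_append.1 hz with hz | hz
    · obtain ⟨y, hy, rfl⟩ := List.mem_map.1 hz
      refine C_smul_mem_congruenceModule_succ ((hG y).2 ⟨0, ?_⟩)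
      rw [smul_zero, sub_zero]
      exact Submodule.subset_span hy
    · rw [List.mem_singleton.1 hz]
      exact ha

/-- If the degree of the minimal polynomial does not grow, then the last of the former columns
becomes superfluous: up to a factor that is invertible modulo `p ^ (t + 1)`, its `p`-fold is a
combination of the other ones. -/
theorem columnsGenerate_replace (hp : Prime p) {t : ℕ} (ht : t ≠ 0)
    {G : List (Fin 1 ⊕ Fin (n ^ 2) → D[X])} {a : Fin 1 ⊕ Fin (n ^ 2) → D[X]}
    {ν : D[X]} {g : Fin (n ^ 2) → D[X]}
    (hG : ColumnsGenerate (Matrix.fromCols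
      (C (p ^ t) • (1 : Matrix (Fin 1 ⊕ Fin (n ^ 2)) (Fin 1 ⊕ Fin (n ^ 2)) D[X]))
      (ofColumns (G ++ [a]))) (congruenceModule p t (mcCoyMatrix e B)))
    (hGp : ∀ b ∈ G, C p ∣ b (Sum.inl 0)) (ha : (a (Sum.inl 0)).Monic)
    (hν : IsMinimalPoly (Ideal.span {p ^ (t + 1)}) B ν) (hg : IsQuotientVector e B ν g)
    (hdeg : ν.degree = (a (Sum.inl 0)).degree) :
    ColumnsGenerate (Matrix.fromCols
      (C (p ^ (t + 1)) • (1 : Matrix (Fin 1 ⊕ Fin (n ^ 2)) (Fin 1 ⊕ Fin (n ^ 2)) D[X]))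
      (ofColumns (G.map (fun a => C p • a) ++ [Sum.elim (fun _ => ν) g])))
      (congruenceModule p (t + 1) (mcCoyMatrix e B)) := by
  have happ := columnsGenerate_append hp hG hν hg
  rw [columnsGenerate_ofColumns_iff] at hG happ ⊢
  set a' : Fin 1 ⊕ Fin (n ^ 2) → D[X] := Sum.elim (fun _ => ν) g with ha'
  set W := Submodule.span D[X] {y | y ∈ G.map (fun a => C p • a) ++ [a']} with hW
  have hmem : a' - a ∈ congruenceModule p t (mcCoyMatrix e B) := by
    refine sub_mem (congruenceModule_succ_le (hg.mem_congruenceModule hν.2.1)) ((hG a).2 ⟨0, ?_⟩)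
    rw [smul_zero, sub_zero]
    exact Submodule.subset_span (by simp)
  obtain ⟨x, hx⟩ := (hG _).1 hmem
  have hset : {y | y ∈ G ++ [a]} = {y | y ∈ G} ∪ {a} := by
    ext y; simp [or_comm]
  rw [hset, Submodule.span_union] at hx
  obtain ⟨y, hy, _, hz, hyz⟩ := Submodule.mem_sup.1 hx
  obtain ⟨z, rfl⟩ := Submodule.mem_span_singleton.1 hz
  have hspan : ∀ y ∈ Submodule.span D[X] {y | y ∈ G}, C p ∣ y (Sum.inl 0) := by
    intro y hy
    induction hy using Submodule.span_induction with
    | mem y hy => exact hGp y hy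
    | zero => exact dvd_zero _
    | add x y _ _ hx hy => exact dvd_add hx hy
    | smul c x _ hx => exact hx.mul_left c
  have hyp := hspan y hy
  -- comparing first coordinates, the coefficient of the column `a` is divisible by `p`
  have hzp : C p ∣ z := by
    have h0 := congrFun hyz (Sum.inl 0)
    simp only [Pi.add_apply, Pi.sub_apply, Pi.smul_apply, smul_eq_mul, ha', Sum.elim_inl] at h0
    refine (dvd_of_dvd_mul_monic_add ha (q := z) (r := a (Sum.inl 0) - ν) ?_ ?_).1
    · refine degree_sub_lt_left hdeg.symm ha.ne_zero ?_
      rw [ha.leadingCoeff, hν.1.leadingCoeff]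
    · have h1 : z * a (Sum.inl 0) + (a (Sum.inl 0) - ν) =
          -(C (p ^ t) * x (Sum.inl 0)) - y (Sum.inl 0) := by
        linear_combination h0
      rw [h1]
      exact dvd_sub ((Dvd.dvd.mul_right (_root_.map_dvd C (dvd_pow_self p ht)) _).neg_right) hyp
  obtain ⟨z, rfl⟩ := hzp
  have hpa : ∃ x', C p • a - C (p ^ (t + 1)) • x' ∈ W := by
    have hcop : IsCoprime (1 + C p * z) (C (p ^ (t + 1))) := by
      rw [C_pow]
      exact IsCoprime.pow_right ⟨1, -z, by ring⟩
    obtain ⟨r, s, hrs⟩ := hcop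
    refine ⟨r • (-x) + s • C p • a, ?_⟩
    have hE : C p • a - C (p ^ (t + 1)) • (r • (-x) + s • C p • a) =
        r • (C p • a' - C p • y) := by
      ext1 k
      have h0 := congrFun hyz k
      simp only [Pi.add_apply, Pi.sub_apply, Pi.smul_apply, Pi.neg_apply, smul_eq_mul] at h0 ⊢
      have h2 : (C (p ^ (t + 1)) : D[X]) = C p * C (p ^ t) := by rw [pow_succ', C_mul]
      rw [h2] at hrs ⊢
      linear_combination (-C p * a k) * hrs + r * C p * h0
    rw [hE]
    refine Submodule.smul_mem _ r (sub_mem (Submodule.smul_mem _ _ (Submodule.subset_span ?_)) ?_)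
    · simp
    · exact Submodule.span_mono (fun z hz => List.mem_append_left _ hz) (C_smul_mem_span_map hy)
  obtain ⟨x', hx'⟩ := hpa
  intro f
  rw [happ f]
  constructor
  · rintro ⟨x₀, hx₀⟩
    have hset' : {y | y ∈ (G ++ [a]).map (fun a => C p • a) ++ [a']} =
        {y | y ∈ G.map (fun a => C p • a) ++ [a']} ∪ {C p • a} := by
      ext y
      simp only [List.map_append, List.map_cons, List.map_nil, List.mem_append, List.mem_singleton,
        Set.mem_ofPred_eq, Set.mem_union, Set.mem_singleton_iff]
      tauto
    rw [hset', Submodule.span_union] at hx₀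
    obtain ⟨y₀, hy₀, _, hz₀, hyz₀⟩ := Submodule.mem_sup.1 hx₀
    obtain ⟨c, rfl⟩ := Submodule.mem_span_singleton.1 hz₀
    refine ⟨x₀ + c • x', ?_⟩
    have hE : f - C (p ^ (t + 1)) • (x₀ + c • x') =
        y₀ + c • (C p • a - C (p ^ (t + 1)) • x') := by
      rw [smul_add, ← sub_sub, ← hyz₀, smul_sub, smul_comm c (C (p ^ (t + 1))) x']
      abel
    rw [hE]
    exact add_mem hy₀ (Submodule.smul_mem _ c hx')
  · rintro ⟨x₀, hx₀⟩
    refine ⟨x₀, Submodule.span_mono (fun y hy => ?_) hx₀⟩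
    simp only [Set.mem_ofPred_eq, List.map_append, List.map_cons, List.map_nil, List.mem_append,
      List.mem_singleton] at hy ⊢
    tauto

end Update

/-! ### The minimal polynomial over the quotient field -/

section Minpoly

variable {D : Type u} [CommRing D] (K : Type v) [Field K] [Algebra D K] {n : ℕ}

theorem map_aeval (B : Matrix (Fin n) (Fin n) D) (f : D[X]) :
    (aeval B f).map (algebraMap D K) = aeval (B.map (algebraMap D K)) f :=
  (aeval_algHom_apply ((Algebra.ofId D K).mapMatrix) B f).symm

variable [IsDomain D] [IsPrincipalIdealRing D] [IsFractionRing D K]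

theorem exists_map_eq_minpoly (B : Matrix (Fin n) (Fin n) D) :
    ∃ μ : D[X], μ.map (algebraMap D K) = minpoly K (B.map (algebraMap D K)) ∧ μ.Monic ∧
      aeval B μ = 0 := by
  have hinj : Function.Injective (algebraMap D K) := IsFractionRing.injective D K
  have hdvd : minpoly K (B.map (algebraMap D K)) ∣ B.charpoly.map (algebraMap D K) := by
    rw [← Matrix.charpoly_map]
    exact Matrix.minpoly_dvd_charpoly _
  obtain ⟨μ, hμ⟩ := IsIntegrallyClosed.eq_map_mul_C_of_dvd K B.charpoly_monic hdvd
  have hm : (minpoly K (B.map (algebraMap D K))).Monic :=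
    minpoly.monic (Matrix.isIntegral _)
  rw [hm.leadingCoeff, C_1, mul_one] at hμ
  refine ⟨μ, hμ, monic_of_injective hinj (hμ ▸ hm), Matrix.map_injective hinj ?_⟩
  dsimp only
  rw [map_aeval, Matrix.map_zero _ (map_zero _), ← aeval_map_algebraMap K, hμ, minpoly.aeval]

/-- If `d < deg μ_B`, a linear form that separates `B ^ d` from the smaller powers of `B` bounds the
exponents `t` for which the `p ^ t`-ideal has a monic element of degree `d`. -/
theorem exists_bound_of_natDegree_lt {p : D} (hp : Prime p) (B : Matrix (Fin n) (Fin n) D) {d : ℕ}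
    (hd : d < (minpoly K (B.map (algebraMap D K))).natDegree) :
    ∃ N, ∀ t, N ≤ t → ∀ f : D[X], f.Monic → f ∈ nullIdealOf (p ^ t) B → f.natDegree ≠ d := by
  have hinj : Function.Injective (algebraMap D K) := IsFractionRing.injective D K
  have hli := linearIndependent_pow (K := K) (B.map (algebraMap D K))
  have hnot := hli.notMem_span_image (s := {i | (i : ℕ) < d}) (x := ⟨d, hd⟩) (by simp)
  obtain ⟨φ, hφ, hker⟩ := Submodule.exists_le_ker_of_notMem hnot
  have hφ0 : ∀ i < d, φ (B.map (algebraMap D K) ^ i) = 0 := fun i hi =>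
    hker (Submodule.subset_span ⟨⟨i, hi.trans hd⟩, hi, rfl⟩)
  -- clearing denominators, the form becomes integral
  obtain ⟨b, hb⟩ := IsLocalization.exist_integer_multiples_of_finite (nonZeroDivisors D)
    (fun ij : Fin n × Fin n => φ (Matrix.single ij.1 ij.2 1))
  choose c hc using hb
  have hψ : ∀ M : Matrix (Fin n) (Fin n) D,
      algebraMap D K (∑ i, ∑ j, M i j * c (i, j)) = (b : D) • φ (M.map (algebraMap D K)) := by
    intro M
    conv_rhs => rw [Matrix.matrix_eq_sum_single (M.map (algebraMap D K))]
    simp only [map_sum, map_mul, Finset.smul_sum, hc]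
    refine Finset.sum_congr rfl fun i _ => Finset.sum_congr rfl fun j _ => ?_
    have : Matrix.single i j (M.map (algebraMap D K) i j) =
        algebraMap D K (M i j) • Matrix.single i j (1 : K) := by
      rw [Matrix.smul_single, smul_eq_mul, mul_one, Matrix.map_apply]
    rw [this, map_smul, smul_eq_mul, Algebra.smul_def, Algebra.smul_def]
    ring
  have hb0 : algebraMap D K b ≠ 0 := by
    rw [Ne, map_eq_zero_iff _ hinj]
    exact nonZeroDivisors.ne_zero b.2
  have hpow : ∀ i, (B ^ i).map (algebraMap D K) = B.map (algebraMap D K) ^ i := fun i =>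
    map_pow (algebraMap D K).mapMatrix B i
  set c₀ := ∑ i, ∑ j, (B ^ d) i j * c (i, j) with hc₀
  have hne : c₀ ≠ 0 := by
    intro h0
    have := hψ (B ^ d)
    rw [← hc₀, h0, map_zero, hpow, Algebra.smul_def, eq_comm, mul_eq_zero] at this
    exact this.elim hb0 hφ
  obtain ⟨N, hN⟩ := FiniteMultiplicity.of_prime_left hp hne
  refine ⟨N + 1, fun t ht f hf hft hfd => hN ((pow_dvd_pow p ht).trans ?_)⟩
  have hval : ∑ i, ∑ j, (aeval B f) i j * c (i, j) = c₀ := by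
    refine hinj ?_
    rw [hψ, hc₀, hψ, map_aeval, ← aeval_map_algebraMap K, aeval_eq_sum_range, hf.natDegree_map,
      hfd, Finset.sum_range_succ, map_add, map_sum, Finset.sum_eq_zero, zero_add, map_smul,
      coeff_map, ← hfd, hf.coeff_natDegree, map_one, one_smul, hpow]
    intro i hi
    rw [map_smul, hφ0 i (Finset.mem_range.1 hi), smul_zero]
  rw [← hval]
  exact Finset.dvd_sum fun i _ => Finset.dvd_sum fun j _ =>
    (mem_nullIdealOf.1 hft i j).mul_right _

/-- For large exponents, the degrees of the minimal polynomials reach `deg μ_B`. -/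
theorem exists_bound {p : D} (hp : Prime p) (B : Matrix (Fin n) (Fin n) D) :
    ∃ N, ∀ t, N ≤ t → ∀ f : D[X], f.Monic → f ∈ nullIdealOf (p ^ t) B →
      (minpoly K (B.map (algebraMap D K))).degree ≤ f.degree := by
  choose! N hN using fun d (hd : d < (minpoly K (B.map (algebraMap D K))).natDegree) =>
    exists_bound_of_natDegree_lt K hp B hd
  refine ⟨(Finset.range (minpoly K (B.map (algebraMap D K))).natDegree).sup N,
    fun t ht f hf hft => ?_⟩
  by_contra! hlt
  have hlt' : f.natDegree < (minpoly K (B.map (algebraMap D K))).natDegree :=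
    natDegree_lt_natDegree hf.ne_zero hlt
  exact hN _ hlt' t ((Finset.le_sup (Finset.mem_range.2 hlt')).trans ht) f hf hft rfl

end Minpoly

/-! ### The structure of the null ideals -/

section Structure

variable {D : Type u} [CommRing D] {n : ℕ} {B : Matrix (Fin n) (Fin n) D} {p : D}

theorem coe_le_nextIndex {S : Finset ℕ} {s t : ℕ} :
    (s : ℕ∞) ≤ nextIndex S t ↔ ∀ r ∈ S, t ≤ r → s ≤ r := by
  rw [nextIndex, le_sInf_iff]
  constructor
  · intro h r hr htr
    exact Nat.cast_le.1 (h _ ⟨r, ⟨hr, htr⟩, rfl⟩)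
  · rintro h _ ⟨r, ⟨hr, htr⟩, rfl⟩
    exact Nat.cast_le.2 (h r hr htr)

theorem describedIdeal_le {S : Finset ℕ} {ν : ℕ → D[X]} (t : ℕ)
    (hν : ∀ s ∈ S, ν s ∈ nullIdealOf (p ^ s) B) :
    describedIdeal p S ν t ≤ nullIdealOf (p ^ t) B := by
  refine sup_le ?_ (iSup_le fun s => iSup_le fun hs => iSup_le fun _ => ?_)
  · rw [Ideal.span_le, Set.singleton_subset_iff]
    have : (1 : D[X]) ∈ nullIdealOf (1 : D) B := by simp [nullIdealOf_one]
    simpa using C_mul_mem_nullIdealOf (a := p ^ t) this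
  · rw [Ideal.span_le, Set.singleton_subset_iff]
    have := C_mul_mem_nullIdealOf (a := p ^ (t - s)) (hν s hs)
    rw [← pow_add] at this
    exact nullIdealOf_pow_anti p (by omega) this

theorem C_pow_mem_describedIdeal (S : Finset ℕ) (ν : ℕ → D[X]) (t : ℕ) :
    C (p ^ t) ∈ describedIdeal p S ν t :=
  Ideal.mem_sup_left (Ideal.mem_span_singleton_self _)

theorem C_pow_mul_mem_describedIdeal {S : Finset ℕ} (ν : ℕ → D[X]) {s t : ℕ} (hs : s ∈ S)
    (hst : (s : ℕ∞) ≤ nextIndex S t) : C (p ^ (t - s)) * ν s ∈ describedIdeal p S ν t := by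
  refine Ideal.mem_sup_right ?_
  refine Submodule.mem_iSup_of_mem s (Submodule.mem_iSup_of_mem hs (Submodule.mem_iSup_of_mem hst ?_))
  exact Ideal.mem_span_singleton_self _

/-- Between an exponent and the next index in `S` the degree of the minimal polynomials is
constant. -/
theorem exists_next_degree_eq {T : ℕ} {ν : ℕ → D[X]} {S : Finset ℕ}
    (hS : ∀ s, s ∈ S ↔ 1 ≤ s ∧ s ≤ T ∧ (s = T ∨ (ν s).degree < (ν (s + 1)).degree))
    (hmono : ∀ s t, s ≤ t → t ≤ T → (ν s).degree ≤ (ν t).degree) {s : ℕ} (h1 : 1 ≤ s)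
    (hs : s ≤ T) : ∃ r ∈ S, s ≤ r ∧ (ν r).degree = (ν s).degree ∧ ∀ r' ∈ S, s ≤ r' → r ≤ r' := by
  induction hs using Nat.decreasingInduction with
  | self => exact ⟨T, (hS T).2 ⟨h1, le_rfl, Or.inl rfl⟩, le_rfl, rfl, fun _ _ h => h⟩
  | of_succ s hs ih =>
    by_cases hsS : s ∈ S
    · exact ⟨s, hsS, le_rfl, rfl, fun _ _ h => h⟩
    · obtain ⟨r, hrS, hr, hdeg, hmin⟩ := ih (by omega)
      have hE : (ν s).degree = (ν (s + 1)).degree := by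
        refine le_antisymm (hmono _ _ (by omega) (by omega)) (not_lt.1 fun hlt => hsS ?_)
        exact (hS s).2 ⟨h1, by omega, Or.inr hlt⟩
      refine ⟨r, hrS, by omega, hdeg.trans hE.symm, fun r' hr' hsr' => hmin r' hr' ?_⟩
      have : r' ≠ s := fun h => hsS (h ▸ hr')
      omega

variable [IsDomain D] [IsPrincipalIdealRing D]

/-- Unfolding the recursion `N t = (ν_t) + p N (t - 1)`, where any minimal polynomials may be
used. -/
theorem C_pow_mul_mem_of_isMinimalPoly (hp : Prime p) (I : Ideal D[X]) (t k : ℕ)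
    (h0 : C (p ^ (k + t)) ∈ I)
    (h : ∀ s, 1 ≤ s → s ≤ t → ∃ ν, IsMinimalPoly (Ideal.span {p ^ s}) B ν ∧
      C (p ^ (k + t - s)) * ν ∈ I) :
    ∀ f ∈ nullIdealOf (p ^ t) B, C (p ^ k) * f ∈ I := by
  induction t generalizing k with
  | zero =>
    intro f _
    exact Ideal.mul_mem_right _ _ h0
  | succ t ih =>
    intro f hf
    obtain ⟨ν, hν, hνI⟩ := h (t + 1) (by omega) le_rfl
    rw [hν.nullIdealOf_succ hp] at hf
    obtain ⟨_, h1, _, h2, rfl⟩ := Submodule.mem_sup.1 hf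
    obtain ⟨a, rfl⟩ := Ideal.mem_span_singleton'.1 h1
    obtain ⟨f', hf', rfl⟩ := Ideal.mem_span_singleton_mul.1 h2
    rw [Nat.add_sub_cancel] at hνI
    have hE : k + (t + 1) = k + 1 + t := by omega
    have := ih (k + 1) (hE ▸ h0) (fun s h1s hst => by
      rw [← hE]
      exact h s h1s (by omega)) f' hf'
    have hsum : C (p ^ k) * (a * ν + C p * f') =
        a * (C (p ^ k) * ν) + C (p ^ (k + 1)) * f' := by
      rw [pow_succ, C_mul]; ring
    rw [hsum]
    exact add_mem (Ideal.mul_mem_left _ _ hνI) this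

/-- The description of all `p ^ t`-ideals by the indices at which the degree of the minimal
polynomial jumps. Here `T` is the last exponent before the degree reaches `deg μ`. -/
theorem describesIdeals (hp : Prime p) {T : ℕ} {ν : ℕ → D[X]} {S : Finset ℕ} {μ : D[X]}
    (hμm : μ.Monic) (hμ : aeval B μ = 0)
    (hν : ∀ s ≤ T, IsMinimalPoly (Ideal.span {p ^ s}) B (ν s))
    (hS : ∀ s, s ∈ S ↔ 1 ≤ s ∧ s ≤ T ∧ (s = T ∨ (ν s).degree < (ν (s + 1)).degree))
    (hT : ∀ f : D[X], f.Monic → f ∈ nullIdealOf (p ^ (T + 1)) B → μ.degree ≤ f.degree) :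
    DescribesIdeals B p μ S ν := by
  have hmono : ∀ s t, s ≤ t → t ≤ T → (ν s).degree ≤ (ν t).degree := fun s t hst ht =>
    (hν s (hst.trans ht)).degree_le (hν t ht) hst
  have hmem : ∀ s ∈ S, ν s ∈ nullIdealOf (p ^ s) B := fun s hs => (hν s ((hS s).1 hs).2.1).2.1
  have key : ∀ (I : Ideal D[X]) (t : ℕ), describedIdeal p S ν t ≤ I → (T < t → μ ∈ I) →
      nullIdealOf (p ^ t) B ≤ I := by
    intro I t hI hμI f hf
    have := C_pow_mul_mem_of_isMinimalPoly hp I t 0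
      (by rw [zero_add]; exact hI (C_pow_mem_describedIdeal S ν t)) (fun s h1 hst => ?_) f hf
    · simpa using this
    rw [zero_add]
    by_cases hsT : s ≤ T
    · obtain ⟨r, hrS, hsr, hdeg, hmin⟩ := exists_next_degree_eq hS hmono h1 hsT
      refine ⟨ν r, (hν s hsT).of_degree_eq (hν r ((hS r).1 hrS).2.1).1 (hmem r hrS) hsr hdeg.le, ?_⟩
      have h2 := hI (C_pow_mul_mem_describedIdeal (p := p) ν hrS (t := t)
        (coe_le_nextIndex.2 fun r' hr' htr' => hmin r' hr' (hst.trans htr')))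
      have h3 : t - s = (t - s - (t - r)) + (t - r) := by omega
      rw [h3, pow_add, C_mul, mul_assoc]
      exact Ideal.mul_mem_left _ _ h2
    · refine ⟨μ, isMinimalPoly_iff.2 ⟨hμm, mem_nullIdealOf_of_aeval_eq_zero _ hμ,
        fun g hg hgs => hT g hg (nullIdealOf_pow_anti p (by omega) hgs)⟩, ?_⟩
      exact Ideal.mul_mem_left _ _ (hμI (by omega))
  refine ⟨fun s hs => ((hS s).1 hs).1, fun s hs => hν s ((hS s).1 hs).2.1,
    fun s hs s' hs' hss' => ?_, fun t _ => ?_, fun t _ htS => ?_⟩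
  · obtain ⟨-, -, h⟩ := (hS s).1 hs
    have hs'T := ((hS s').1 hs').2.1
    exact (h.resolve_left (by omega)).trans_le (hmono _ _ hss' hs'T)
  · refine le_antisymm (key _ t le_sup_right fun _ =>
      Ideal.mem_sup_left (Ideal.mem_span_singleton_self μ)) (sup_le ?_ (describedIdeal_le t hmem))
    rw [Ideal.span_le, Set.singleton_subset_iff]
    exact mem_nullIdealOf_of_aeval_eq_zero _ hμ
  · refine le_antisymm (key _ t le_rfl fun hTt => ?_) (describedIdeal_le t hmem)
    have hmax : S.max ≤ (T : WithBot ℕ) := Finset.max_le fun s hs =>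
      WithBot.coe_le_coe.2 ((hS s).1 hs).2.1
    have : t ≤ T := by exact_mod_cast htS.trans hmax
    omega

end Structure

/-! ### The reduction procedure -/

section Reduce

variable {D : Type u} [CommRing D] {n : ℕ}

theorem HasGeneratingProperty.mem {B : Matrix (Fin n) (Fin n) D} {p : D} {t : ℕ} {F : Set D[X]}
    (h : HasGeneratingProperty p B (t + 1) F) {f : D[X]} (hf : f ∈ F) :
    f ∈ nullIdealOf (p ^ (t + 1)) B := by
  rw [h]
  exact Ideal.mem_sup_left (Ideal.subset_span hf)

theorem HasGeneratingProperty.of_forall_mem {B : Matrix (Fin n) (Fin n) D} {p : D} {t : ℕ}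
    {F F' : Set D[X]} (h : HasGeneratingProperty p B (t + 1) F)
    (hF : ∀ f ∈ F, f ∈ Ideal.span F' ⊔ Ideal.span {C p} * nullIdealOf (p ^ t) B)
    (hF' : ∀ f ∈ F', f ∈ nullIdealOf (p ^ (t + 1)) B) :
    HasGeneratingProperty p B (t + 1) F' := by
  refine le_antisymm ?_ (sup_le (Ideal.span_le.2 hF') (C_mul_nullIdealOf_le p t))
  rw [HasGeneratingProperty] at h
  rw [h]
  exact sup_le (Ideal.span_le.2 hF) le_sup_right

/-- The invariant of a call of the replacement procedure, where `F` is the set of the polynomials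
that are not being processed. There is only one iteration: before it, the current polynomial is the
input, and after it, the current polynomial is divisible by `p`. -/
def CallInv (p : D) (B : Matrix (Fin n) (Fin n) D) (t : ℕ) (F : Finset D[X])
    (c : ReplaceState D) : Prop :=
  (c.hs = [] ∧ ¬ C p ∣ c.f ∧ HasGeneratingProperty p B (t + 1) (insert c.f (F : Set D[X]))) ∨
    ∃ h, c.hs = [h] ∧ C p ∣ c.f ∧ h.Monic ∧
      HasGeneratingProperty p B (t + 1) (insert h (F : Set D[X]))

/-- The invariant of the reduction procedure that computes a `p ^ (t + 1)`-minimal polynomial. -/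
def ReduceInv (p : D) (B : Matrix (Fin n) (Fin n) D) (t : ℕ) : ReduceState D → Prop
  | .start F => HasGeneratingProperty p B (t + 1) (F : Set D[X])
  | .normalize F => HasGeneratingProperty p B (t + 1) (F : Set D[X]) ∧ ∀ f ∈ F, ¬ C p ∣ f
  | .normalizeCall F c => CallInv p B t F c ∧ ∀ f ∈ F, ¬ C p ∣ f
  | .loop F g => HasGeneratingProperty p B (t + 1) (F : Set D[X]) ∧ (∀ f ∈ F, f.Monic) ∧ g ∈ F
  | .loopCall F c => CallInv p B t F c ∧ ∀ f ∈ F, f.Monic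
  | .halt g => IsMinimalPoly (Ideal.span {p ^ (t + 1)}) B g

/-- The degree of the result of the replacement procedure, or a bound for it while there is no
result. -/
def callDegree (c : ReplaceState D) : ℕ :=
  match c.hs with
  | [] => c.f.natDegree
  | h :: _ => h.natDegree

theorem toLex_lt_toLex_iff {a b c a' b' c' : ℕ} :
    (toLex (a, toLex (b, c)) : ℕ ×ₗ (ℕ ×ₗ ℕ)) < toLex (a', toLex (b', c')) ↔
      a < a' ∨ a = a' ∧ (b < b' ∨ b = b' ∧ c < c') := by
  rw [Prod.Lex.toLex_lt_toLex, Prod.Lex.toLex_lt_toLex]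

open Classical in
/-- A measure for the termination of the reduction procedure: its phase, then the number of
non-monic polynomials or the degree of the chosen polynomial (doubled, to leave room for the calls),
then the number of remaining polynomials or of pending iterations of a call. -/
noncomputable def reduceRank : ReduceState D → ℕ ×ₗ (ℕ ×ₗ ℕ)
  | .start _ => toLex (2, toLex (0, 0))
  | .normalize F => toLex (1, toLex (2 * (F.filter fun f => ¬ f.Monic).card, 0))
  | .normalizeCall F c =>
      toLex (1, toLex (2 * (F.filter fun f => ¬ f.Monic).card + 1, if c.hs = [] then 1 else 0))
  | .loop F g => toLex (0, toLex (2 * g.natDegree, F.card))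
  | .loopCall _ c => toLex (0, toLex (2 * callDegree c + 1, if c.hs = [] then 1 else 0))
  | .halt _ => toLex (0, toLex (0, 0))

variable {B : Matrix (Fin n) (Fin n) D} {p : D} {t : ℕ} {ν : D[X]}

theorem CallInv.eq_of_dvd {F : Finset D[X]} {f : D[X]} {hs : List D[X]}
    (hc : CallInv p B t F ⟨f, hs⟩) (hf : C p ∣ f) :
    ∃ h, hs = [h] ∧ h.Monic ∧ HasGeneratingProperty p B (t + 1) (insert h (F : Set D[X])) := by
  rcases hc with ⟨-, hf', -⟩ | ⟨h, hhs, -, hm, hgen⟩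
  · exact absurd hf hf'
  · exact ⟨h, hhs, hm, hgen⟩

variable [IsDomain D]

/-- An iteration of the replacement procedure is the last one: the new monic polynomial is
associated to the current one modulo `p`, so the remainder vanishes modulo `p`. -/
theorem CallInv.step (hp : Prime p) (hνm : ν.Monic) (hν : ν ∈ nullIdealOf (p ^ t) B)
    {F : Finset D[X]} {c c' : ReplaceState D} (hc : CallInv p B t F c)
    (H : ReplaceStep p ν c c') :
    CallInv p B t F c' ∧ c.hs = [] ∧ c'.hs ≠ [] ∧ callDegree c' ≤ callDegree c := by
  obtain ⟨f, h, q, r, hs, hf, hh, hdiv, hr⟩ := H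
  rcases hc with ⟨hhs, -, hgen⟩ | ⟨_, -, hf', -⟩
  swap
  · exact absurd hf' hf
  dsimp only at hhs hgen
  subst hhs
  have hfm := hgen.mem (Set.mem_insert f _)
  obtain ⟨hm, hmem, hle, w, hw⟩ := hh.spec hνm hν hfm hf
  have hpr : C p ∣ r := by
    refine (dvd_of_dvd_mul_monic_add (q := q - C w) hm hr ?_).2
    convert hw using 1
    linear_combination -hdiv
  have hrm : r ∈ nullIdealOf (p ^ (t + 1)) B := by
    have : r = f - q * h := by linear_combination -hdiv
    rw [this]
    exact sub_mem hfm (Ideal.mul_mem_left _ _ hmem)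
  refine ⟨Or.inr ⟨h, rfl, hpr, hm, hgen.of_forall_mem ?_ ?_⟩, rfl, by simp, hle⟩
  · rintro x (rfl | hx)
    · rw [hdiv]
      exact Submodule.add_mem_sup (Ideal.mul_mem_left _ _ (Ideal.subset_span (Set.mem_insert _ _)))
        (mem_C_mul_nullIdealOf_of_dvd hp.ne_zero hrm hpr)
    · exact Ideal.mem_sup_left (Ideal.subset_span (Set.mem_insert_of_mem _ hx))
  · rintro x (rfl | hx)
    · exact hmem
    · exact hgen.mem (Set.mem_insert_of_mem _ hx)

theorem ReduceInv.step (hp : Prime p) (hνm : ν.Monic) (hν : ν ∈ nullIdealOf (p ^ t) B)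
    {c c' : ReduceState D} (hc : ReduceInv p B t c) (H : ReduceStep p ν c c') :
    ReduceInv p B t c' ∧ reduceRank c' < reduceRank c := by
  classical
  have hdvd : ∀ {f}, f ∈ nullIdealOf (p ^ (t + 1)) B → C p ∣ f →
      f ∈ Ideal.span {C p} * nullIdealOf (p ^ t) B :=
    fun hf hd => mem_C_mul_nullIdealOf_of_dvd hp.ne_zero hf hd
  cases H with
  | delete F =>
    refine ⟨⟨HasGeneratingProperty.of_forall_mem hc (fun f hf => ?_) (fun f hf => ?_), ?_⟩, ?_⟩
    · by_cases hd : C p ∣ f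
      · exact Ideal.mem_sup_right (hdvd (HasGeneratingProperty.mem hc hf) hd)
      · exact Ideal.mem_sup_left (Ideal.subset_span (by simpa [hd] using hf))
    · exact HasGeneratingProperty.mem hc (by simpa using (Finset.mem_filter.1 hf).1)
    · exact fun f hf => (Finset.mem_filter.1 hf).2
    · simp [reduceRank, toLex_lt_toLex_iff]
  | normalizeCall F f hf hm =>
    refine ⟨⟨Or.inl ⟨rfl, hc.2 f hf, ?_⟩, fun g hg => hc.2 g (Finset.mem_of_mem_erase hg)⟩, ?_⟩
    · rw [← Finset.coe_insert, Finset.insert_erase hf]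
      exact hc.1
    · have h1 : ((F.erase f).filter fun f => ¬ f.Monic).card <
          (F.filter fun f => ¬ f.Monic).card := by
        refine Finset.card_lt_card ((Finset.filter_subset_filter _
          (Finset.erase_subset f F)).ssubset_of_mem_notMem (a := f) ?_ ?_)
        · simp [hf, hm]
        · simp
      rw [reduceRank, reduceRank, toLex_lt_toLex_iff]
      omega
  | normalizeRun F c c' hcc' =>
    obtain ⟨h1, h2, h3, -⟩ := hc.1.step hp hνm hν hcc'
    exact ⟨⟨h1, hc.2⟩, by simp [reduceRank, toLex_lt_toLex_iff, h2, h3]⟩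
  | normalizeReturn F f hs hf =>
    obtain ⟨h, rfl, hm, hgen⟩ := hc.1.eq_of_dvd hf
    have hset : F ∪ [h].toFinset = insert h F := by simp
    rw [hset]
    refine ⟨⟨by rwa [Finset.coe_insert], ?_⟩, ?_⟩
    · intro f hf
      rcases Finset.mem_insert.1 hf with rfl | hf
      · exact not_C_dvd_of_monic hp.not_isUnit hm
      · exact hc.2 f hf
    · have h1 : (insert h F).filter (fun f => ¬ f.Monic) = F.filter fun f => ¬ f.Monic := by
        rw [Finset.filter_insert, if_neg (not_not.2 hm)]
      rw [reduceRank, reduceRank, toLex_lt_toLex_iff, h1]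
      omega
  | chooseMin F g hF hg hmin =>
    exact ⟨⟨hc.1, hF, hg⟩, by simp [reduceRank, toLex_lt_toLex_iff]⟩
  | remove F g f q r hf hfg hdiv hr hd =>
    have hrm : r ∈ nullIdealOf (p ^ (t + 1)) B := by
      have : r = f - q * g := by linear_combination -hdiv
      rw [this]
      exact sub_mem (hc.1.mem hf) (Ideal.mul_mem_left _ _ (hc.1.mem hc.2.2))
    obtain ⟨hgen, hm, hg⟩ := hc
    have hg' : g ∈ F.erase f := Finset.mem_erase.2 ⟨hfg.symm, hg⟩
    refine ⟨⟨hgen.of_forall_mem (fun x hx => ?_) fun x hx =>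
      hgen.mem (Finset.mem_of_mem_erase hx), fun x hx => hm x (Finset.mem_of_mem_erase hx), hg'⟩, ?_⟩
    · by_cases hxf : x = f
      · rw [hxf]
        refine (congrArg (· ∈ _) hdiv).mpr ?_
        exact Submodule.add_mem_sup (Ideal.mul_mem_left _ _ (Ideal.subset_span hg')) (hdvd hrm hd)
      · exact Ideal.mem_sup_left (Ideal.subset_span (Finset.mem_erase.2 ⟨hxf, hx⟩))
    · have := Finset.card_erase_lt_of_mem hf
      rw [reduceRank, reduceRank, toLex_lt_toLex_iff]
      omega
  | loopCall F g f q r hf hfg hdiv hr hd =>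
    have hrm : r ∈ nullIdealOf (p ^ (t + 1)) B := by
      have : r = f - q * g := by linear_combination -hdiv
      rw [this]
      exact sub_mem (hc.1.mem hf) (Ideal.mul_mem_left _ _ (hc.1.mem hc.2.2))
    obtain ⟨hgen, hm, hg⟩ := hc
    have hg' : g ∈ F.erase f := Finset.mem_erase.2 ⟨hfg.symm, hg⟩
    refine ⟨⟨Or.inl ⟨rfl, hd, hgen.of_forall_mem (fun x hx => ?_) ?_⟩,
      fun x hx => hm x (Finset.mem_of_mem_erase hx)⟩, ?_⟩
    · refine Ideal.mem_sup_left ?_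
      by_cases hxf : x = f
      · rw [hxf]
        refine (congrArg (· ∈ _) hdiv).mpr ?_
        exact add_mem (Ideal.mul_mem_left _ _ (Ideal.subset_span (Set.mem_insert_of_mem _ hg')))
          (Ideal.subset_span (Set.mem_insert _ _))
      · exact Ideal.subset_span (Set.mem_insert_of_mem _ (Finset.mem_erase.2 ⟨hxf, hx⟩))
    · rintro x (rfl | hx)
      · exact hrm
      · exact hgen.mem (Finset.mem_of_mem_erase hx)
    · have hr0 : r ≠ 0 := fun h0 => hd (h0 ▸ dvd_zero _)
      have := natDegree_lt_natDegree hr0 hr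
      rw [reduceRank, reduceRank, toLex_lt_toLex_iff]
      refine Or.inr ⟨rfl, Or.inl ?_⟩
      change 2 * r.natDegree + 1 < 2 * g.natDegree
      omega
  | loopRun F c c' hcc' =>
    obtain ⟨h1, h2, h3, h4⟩ := hc.1.step hp hνm hν hcc'
    refine ⟨⟨h1, hc.2⟩, ?_⟩
    rw [reduceRank, reduceRank, toLex_lt_toLex_iff, if_pos h2, if_neg h3]
    omega
  | loopReturn F f hs h hf =>
    obtain ⟨h', hhs, hm, hgen⟩ := hc.1.eq_of_dvd hf
    obtain ⟨rfl, rfl⟩ : hs = [] ∧ h = h' := by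
      cases hs <;> simp_all
    have hset : F ∪ ([] ++ [h]).toFinset = insert h F := by simp
    rw [hset]
    refine ⟨⟨by rwa [Finset.coe_insert], ?_, Finset.mem_insert_self _ _⟩, ?_⟩
    · intro f hf
      rcases Finset.mem_insert.1 hf with rfl | hf
      · exact hm
      · exact hc.2 f hf
    · rw [reduceRank, reduceRank, toLex_lt_toLex_iff]
      exact Or.inr ⟨rfl, Or.inl (Nat.lt_succ_self (2 * h.natDegree))⟩
  | finish F g hF =>
    obtain ⟨hgen, hm, hg⟩ := hc
    have hset : (F : Set D[X]) = {g} := by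
      ext x
      exact ⟨fun hx => hF x hx, fun hx => by rw [Set.mem_singleton_iff.1 hx]; exact hg⟩
    refine ⟨isMinimalPoly_of_nullIdealOf_succ hp.not_isUnit (hm g hg) ?_, ?_⟩
    · rw [hset] at hgen
      exact hgen
    · have := Finset.card_pos.2 ⟨g, hg⟩
      rw [reduceRank, reduceRank, toLex_lt_toLex_iff]
      omega

variable [IsPrincipalIdealRing D]

theorem CallInv.exists_step (hp : Prime p) (hν : IsMinimalPoly (Ideal.span {p ^ t}) B ν)
    {F : Finset D[X]} {c : ReplaceState D} (hc : CallInv p B t F c) (hf : ¬ C p ∣ c.f) :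
    ∃ c', ReplaceStep p ν c c' := by
  obtain ⟨f, hs⟩ := c
  rcases hc with ⟨-, -, hgen⟩ | ⟨_, -, hf', -⟩
  swap
  · exact absurd hf' hf
  have hfm := hgen.mem (Set.mem_insert f _)
  obtain ⟨h, hh⟩ := FindMonic.exists_of_isMinimalPoly hp hν hfm hf
  have hm := (hh.spec hν.1 hν.2.1 hfm hf).1
  refine ⟨_, ReplaceStep.iterate f h (f /ₘ h) (f %ₘ h) hs hf hh ?_ (degree_modByMonic_lt f hm)⟩
  conv_lhs => rw [← modByMonic_add_div f h]
  ring

/-- The reduction procedure does not get stuck. -/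
theorem ReduceInv.exists_step (hp : Prime p) (hν : IsMinimalPoly (Ideal.span {p ^ t}) B ν)
    {c : ReduceState D} (hc : ReduceInv p B t c) :
    (∃ g, c = .halt g) ∨ ∃ c', ReduceStep p ν c c' := by
  classical
  cases c with
  | start F => exact Or.inr ⟨_, .delete F⟩
  | normalize F =>
    right
    by_cases hF : ∀ f ∈ F, f.Monic
    · -- the set is not empty, as the `p ^ (t + 1)`-ideal contains a monic polynomial
      have hne : F.Nonempty := by
        rw [Finset.nonempty_iff_ne_empty]
        rintro rfl
        have h1 := charpoly_mem_nullIdealOf (B := B) (p ^ (t + 1))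
        have h2 := hc.1
        rw [HasGeneratingProperty] at h2
        rw [h2, Finset.coe_empty, Ideal.span_empty, bot_sup_eq] at h1
        obtain ⟨z, -, hz⟩ := Ideal.mem_span_singleton_mul.1 h1
        exact not_C_dvd_of_monic hp.not_isUnit B.charpoly_monic ⟨z, hz.symm⟩
      obtain ⟨g, hg, hmin⟩ := Finset.exists_min_image F degree hne
      exact ⟨_, .chooseMin F g hF hg hmin⟩
    · push Not at hF
      obtain ⟨f, hf, hm⟩ := hF
      exact ⟨_, .normalizeCall F f hf hm⟩
  | normalizeCall F c =>
    right
    by_cases hf : C p ∣ c.f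
    · exact ⟨_, .normalizeReturn F c.f c.hs hf⟩
    · obtain ⟨c', hc'⟩ := hc.1.exists_step hp hν hf
      exact ⟨_, .normalizeRun F c c' hc'⟩
  | loop F g =>
    right
    by_cases hF : ∀ f ∈ F, f = g
    · exact ⟨_, .finish F g hF⟩
    · push Not at hF
      obtain ⟨f, hf, hfg⟩ := hF
      have hgm := hc.2.1 g hc.2.2
      have hdiv : f = (f /ₘ g) * g + f %ₘ g := by
        conv_lhs => rw [← modByMonic_add_div f g]
        ring
      have hr := degree_modByMonic_lt f hgm
      by_cases hd : C p ∣ f %ₘ g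
      · exact ⟨_, .remove F g f _ _ hf hfg hdiv hr hd⟩
      · exact ⟨_, .loopCall F g f _ _ hf hfg hdiv hr hd⟩
  | loopCall F c =>
    right
    by_cases hf : C p ∣ c.f
    · obtain ⟨f, hs⟩ := c
      obtain ⟨h, rfl, -⟩ := hc.1.eq_of_dvd hf
      exact ⟨_, .loopReturn F f [] h hf⟩
    · obtain ⟨c', hc'⟩ := hc.1.exists_step hp hν hf
      exact ⟨_, .loopRun F c c' hc'⟩
  | halt g => exact Or.inl ⟨g, rfl⟩

end Reduce

/-! ### The main algorithm -/

section Main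

variable {D : Type u} [CommRing D] (K : Type v) [Field K] [Algebra D K] {n : ℕ}

/-- The invariant at the head of the main loop: all `ν s` with `s ≤ t` are minimal polynomials,
the matrix `G` generates the solutions modulo `p ^ t`, and `S` consists of the indices at which the
degree of `ν` is about to jump, together with `t`. All columns of `G` but the last one, which
starts with `ν t`, are divisible by `p` in their first entry. -/
structure HeadInv (e : Fin (n ^ 2) ≃ Fin n × Fin n) (B : Matrix (Fin n) (Fin n) D) (p : D)
    (t : ℕ) (S : Finset ℕ) (ν : ℕ → D[X]) (G : List (Fin 1 ⊕ Fin (n ^ 2) → D[X])) : Prop where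
  minimal : ∀ s ≤ t, IsMinimalPoly (Ideal.span {p ^ s}) B (ν s)
  generate : ColumnsGenerate (Matrix.fromCols
    (C (p ^ t) • (1 : Matrix (Fin 1 ⊕ Fin (n ^ 2)) (Fin 1 ⊕ Fin (n ^ 2)) D[X])) (ofColumns G))
    (congruenceModule p t (mcCoyMatrix e B))
  mem_iff : ∀ s, s ∈ S ↔ 1 ≤ s ∧ s ≤ t ∧ (s = t ∨ (ν s).degree < (ν (s + 1)).degree)
  degree_lt : t ≠ 0 → (ν t).degree < (minpoly K (B.map (algebraMap D K))).degree
  columns : t ≠ 0 → ∃ G' a, G = G' ++ [a] ∧ a (Sum.inl 0) = ν t ∧ ∀ b ∈ G', C p ∣ b (Sum.inl 0)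

/-- The invariant of the main algorithm, where `μ` is the minimal polynomial of `B`. -/
def StateInv (e : Fin (n ^ 2) ≃ Fin n × Fin n) (B : Matrix (Fin n) (Fin n) D) (p : D) (μ : D[X]) :
    State D n → Prop
  | .head t S ν G => HeadInv K e B p t S ν G
  | .lifted t S ν G F => ∃ t', t = t' + 1 ∧ HeadInv K e B p t' S ν G ∧
      ColumnsGenerate
        (Matrix.fromCols
          (C (p ^ t) • (1 : Matrix (Fin 1 ⊕ Fin (n ^ 2)) (Fin 1 ⊕ Fin (n ^ 2)) D[X]))
          (Matrix.fromCols F (C p • ofColumns G)))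
        (congruenceModule p t (mcCoyMatrix e B))
  | .computing t S ν G c => ∃ t', t = t' + 1 ∧ HeadInv K e B p t' S ν G ∧ ReduceInv p B t' c
  | .assigned t S ν G => ∃ t', t = t' + 1 ∧ HeadInv K e B p t' S ν G ∧
      IsMinimalPoly (Ideal.span {p ^ t}) B (ν t)
  | .halt S ν => DescribesIdeals B p μ S ν

/-- A measure for the termination of the main algorithm, where `N` bounds the loop counter: the
number of remaining passes, then the position in the loop, then the progress of the reduction. -/
noncomputable def stateRank (N : ℕ) : State D n → ℕ ×ₗ (ℕ ×ₗ (ℕ ×ₗ (ℕ ×ₗ ℕ)))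
  | .head t _ _ _ => toLex (N + 1 - t, toLex (1, toLex (0, toLex (0, 0))))
  | .lifted t _ _ _ _ => toLex (N + 1 - t, toLex (4, toLex (0, toLex (0, 0))))
  | .computing t _ _ _ c => toLex (N + 1 - t, toLex (3, reduceRank c))
  | .assigned t _ _ _ => toLex (N + 1 - t, toLex (2, toLex (0, toLex (0, 0))))
  | .halt _ _ => toLex (0, toLex (0, toLex (0, toLex (0, 0))))

variable {e : Fin (n ^ 2) ≃ Fin n × Fin n} {B : Matrix (Fin n) (Fin n) D} {p : D} {μ : D[X]}

theorem HeadInv.congr {t : ℕ} {S : Finset ℕ} {ν ν' : ℕ → D[X]}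
    {G : List (Fin 1 ⊕ Fin (n ^ 2) → D[X])} (h : HeadInv K e B p t S ν G)
    (hν : ∀ s ≤ t, ν' s = ν s) : HeadInv K e B p t S ν' G := by
  refine ⟨fun s hs => hν s hs ▸ h.minimal s hs, h.generate, fun s => ?_, fun ht => ?_, fun ht => ?_⟩
  · rw [h.mem_iff]
    refine and_congr_right fun _ => and_congr_right fun hst => ?_
    rcases hst.eq_or_lt with rfl | hlt
    · simp
    · rw [hν s hst, hν (s + 1) hlt]
  · rw [hν t le_rfl]
    exact h.degree_lt ht
  · rw [hν t le_rfl]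
    exact h.columns ht

theorem headInv_zero : HeadInv K e B p 0 ∅ (fun _ => 1) [] := by
  refine ⟨fun s hs => ?_, ?_, fun s => ?_, fun h => absurd rfl h, fun h => absurd rfl h⟩
  · rw [Nat.le_zero.1 hs, pow_zero]
    exact isMinimalPoly_one
  · rw [columnsGenerate_ofColumns_iff]
    refine fun f => iff_of_true (fun i => ?_) ⟨f, ?_⟩
    · rw [pow_zero, C_1]
      exact one_dvd _
    · rw [pow_zero, C_1, one_smul, sub_self]
      exact zero_mem _
  · simp only [Finset.notMem_empty, false_iff]
    omega

/-- If `deg ν_1 = 0`, then `B` is the empty matrix, and the algorithm returns. -/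
theorem HeadInv.ne_zero_of_degree_eq (hp : Prime p) {t : ℕ} {S : Finset ℕ} {ν : ℕ → D[X]}
    {G : List (Fin 1 ⊕ Fin (n ^ 2) → D[X])} (h : HeadInv K e B p t S ν G)
    (hν : IsMinimalPoly (Ideal.span {p ^ (t + 1)}) B (ν (t + 1)))
    (hdeg : (ν (t + 1)).degree < (minpoly K (B.map (algebraMap D K))).degree)
    (heq : (ν (t + 1)).degree = (ν t).degree) : t ≠ 0 := by
  rintro rfl
  have h0 : (ν 0).degree ≤ (1 : D[X]).degree := by
    refine (h.minimal 0 le_rfl).2.2 1 monic_one ?_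
    change _ ∈ nullIdealOf (p ^ 0) B
    simp [nullIdealOf_one]
  rw [← heq] at h0
  have h1 : ν (0 + 1) = 1 :=
    (Monic.natDegree_eq_zero hν.1).1 (natDegree_eq_zero_iff_degree_le_zero.2
      (h0.trans degree_one_le))
  have h2 := hν.2.1
  rw [h1] at h2
  have h3 : ∀ i j, p ^ (0 + 1) ∣ (aeval B (1 : D[X])) i j := mem_nullIdealOf.1 h2
  rcases isEmpty_or_nonempty (Fin n) with he | ⟨⟨i⟩⟩
  · rw [h1] at hdeg
    have h4 : (minpoly K (B.map (algebraMap D K))).degree ≤ (1 : K[X]).degree :=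
      minpoly.min K _ monic_one (Subsingleton.elim _ _)
    have : Nontrivial D := ⟨⟨p, 0, hp.ne_zero⟩⟩
    rw [degree_one] at h4 hdeg
    exact not_lt.2 h4 hdeg
  · have h4 := h3 i i
    rw [map_one, Matrix.one_apply_eq, zero_add, pow_one] at h4
    exact hp.not_isUnit (isUnit_of_dvd_one h4)

/-- At the end of a pass through the loop the invariant holds again, once the new generators are
known to be sufficient and the new index set is correct. -/
theorem HeadInv.succ {t : ℕ} {S S' : Finset ℕ} {ν : ℕ → D[X]}
    {G G' : List (Fin 1 ⊕ Fin (n ^ 2) → D[X])} {g : Fin (n ^ 2) → D[X]}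
    (h : HeadInv K e B p t S ν G)
    (hν : IsMinimalPoly (Ideal.span {p ^ (t + 1)}) B (ν (t + 1)))
    (hdeg : (ν (t + 1)).degree < (minpoly K (B.map (algebraMap D K))).degree)
    (hgen : ColumnsGenerate (Matrix.fromCols
      (C (p ^ (t + 1)) • (1 : Matrix (Fin 1 ⊕ Fin (n ^ 2)) (Fin 1 ⊕ Fin (n ^ 2)) D[X]))
      (ofColumns (G'.map (fun a => C p • a) ++ [Sum.elim (fun _ => ν (t + 1)) g])))
      (congruenceModule p (t + 1) (mcCoyMatrix e B)))
    (hS' : ∀ s, s ∈ S' ↔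
      s = t + 1 ∨ s ∈ S ∧ (s = t → (ν s).degree < (ν (s + 1)).degree)) :
    HeadInv K e B p (t + 1) S' ν
      (G'.map (fun a => C p • a) ++ [Sum.elim (fun _ => ν (t + 1)) g]) := by
  refine ⟨fun s hs => ?_, hgen, fun s => ?_, fun _ => hdeg, fun _ => ⟨_, _, rfl, rfl, ?_⟩⟩
  · rcases hs.eq_or_lt with rfl | hlt
    · exact hν
    · exact h.minimal s (Nat.lt_succ_iff.1 hlt)
  · rw [hS', h.mem_iff]
    constructor
    · rintro (rfl | ⟨⟨h1, h2, h3⟩, h4⟩)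
      · exact ⟨by omega, le_rfl, Or.inl rfl⟩
      · exact ⟨h1, by omega, Or.inr (h3.elim h4 id)⟩
    · rintro ⟨h1, h2, h3⟩
      rcases h3 with h3 | h3
      · exact Or.inl h3
      · rcases h2.eq_or_lt with h2 | h2
        · exact Or.inl h2
        · exact Or.inr ⟨⟨h1, by omega, Or.inr h3⟩, fun _ => h3⟩
  · intro b hb
    obtain ⟨a, -, rfl⟩ := List.mem_map.1 hb
    exact dvd_mul_right _ _

theorem StateInv.assertion {c : State D n} (hc : StateInv K e B p μ c) : Assertion e B p c := by
  cases c with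
  | head t S ν G => exact hc.generate
  | lifted t S ν G F =>
    obtain ⟨t, rfl, -, hF⟩ := hc
    exact hF
  | computing t S ν G c =>
    obtain ⟨t, rfl, -, hc⟩ := hc
    cases c with
    | start F => exact hc
    | _ => trivial
  | assigned t S ν G =>
    obtain ⟨t, rfl, -, hν⟩ := hc
    exact hν
  | halt S ν => trivial

variable [IsDomain D] [IsPrincipalIdealRing D]

theorem StateInv.step [IsFractionRing D K] (hp : Prime p)
    (hμ : μ.map (algebraMap D K) = minpoly K (B.map (algebraMap D K))) (hμm : μ.Monic)
    (hμB : aeval B μ = 0) {N : ℕ}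
    (hN : ∀ t, N ≤ t → ∀ f : D[X], f.Monic → f ∈ nullIdealOf (p ^ t) B →
      (minpoly K (B.map (algebraMap D K))).degree ≤ f.degree)
    {c c' : State D n} (hc : StateInv K e B p μ c) (H : Step K e B p c c') :
    StateInv K e B p μ c' ∧ stateRank N c' < stateRank N c := by
  classical
  cases H with
  | lift t S ν G F hF =>
    refine ⟨⟨t, rfl, hc, Lifting.columnsGenerate hp
      (eq_zero_of_vecMul_reduceMod_mcCoyMatrix e) hc.generate hF⟩, ?_⟩
    have ht : t < N + 1 := by
      by_contra! hlt
      have h := hc.minimal t le_rfl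
      exact not_lt.2 (hN t (by omega) _ h.1 h.2.1) (hc.degree_lt (by omega))
    rw [stateRank, stateRank, Prod.Lex.toLex_lt_toLex]
    left
    change N + 1 - (t + 1) < N + 1 - t
    omega
  | call t S ν G F =>
    obtain ⟨t, rfl, hh, hF⟩ := hc
    refine ⟨⟨t, rfl, hh, ?_⟩, ?_⟩
    · have := hasGeneratingProperty_of_columnsGenerate e hh.generate hF
      rw [ReduceInv, Finset.coe_image, Finset.coe_univ, Set.image_univ]
      exact this
    · rw [stateRank, stateRank, Prod.Lex.toLex_lt_toLex, Prod.Lex.toLex_lt_toLex]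
      exact Or.inr ⟨rfl, Or.inl (by norm_num)⟩
  | run t S ν G c c' hcc' =>
    obtain ⟨t, rfl, hh, hc⟩ := hc
    rw [Nat.add_sub_cancel] at hcc'
    have hmin := hh.minimal t le_rfl
    obtain ⟨h1, h2⟩ := hc.step hp hmin.1 hmin.2.1 hcc'
    refine ⟨⟨t, rfl, hh, h1⟩, ?_⟩
    rw [stateRank, stateRank, Prod.Lex.toLex_lt_toLex, Prod.Lex.toLex_lt_toLex]
    exact Or.inr ⟨rfl, Or.inr ⟨rfl, h2⟩⟩
  | assign t S ν G g =>
    obtain ⟨t, rfl, hh, hc⟩ := hc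
    refine ⟨⟨t, rfl, hh.congr K fun s hs => Function.update_of_ne (by omega) _ _, ?_⟩, ?_⟩
    · rw [Function.update_self]
      exact hc
    · rw [stateRank, stateRank, Prod.Lex.toLex_lt_toLex, Prod.Lex.toLex_lt_toLex]
      exact Or.inr ⟨rfl, Or.inl (by norm_num)⟩
  | ret t S ν G hdeg =>
    obtain ⟨t, rfl, hh, hν⟩ := hc
    refine ⟨describesIdeals hp hμm hμB hh.minimal hh.mem_iff fun f hf hft => ?_, ?_⟩
    · rw [← hμ, hμm.degree_map] at hdeg
      exact hdeg.trans (hν.2.2 f hf hft)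
    · rw [stateRank, stateRank, Prod.Lex.toLex_lt_toLex, Prod.Lex.toLex_lt_toLex]
      rcases Nat.eq_zero_or_pos (N + 1 - (t + 1)) with h0 | h0
      · exact Or.inr ⟨h0.symm, Or.inl (by norm_num)⟩
      · exact Or.inl h0
  | replace t S ν G a g hdeg hg heq =>
    obtain ⟨t, rfl, hh, hν⟩ := hc
    rw [Nat.add_sub_cancel] at heq ⊢
    have ht := hh.ne_zero_of_degree_eq K hp hν hdeg heq
    obtain ⟨G', a', hG, ha, hG'⟩ := hh.columns ht
    obtain ⟨rfl, hG₂⟩ := List.append_inj' hG rfl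
    obtain rfl : a = a' := by simpa using hG₂
    refine ⟨hh.succ K hν hdeg (columnsGenerate_replace hp ht hh.generate hG'
      (ha ▸ (hh.minimal t le_rfl).1) hν hg (ha ▸ heq)) fun s => ?_, ?_⟩
    · rw [Finset.mem_insert, Finset.mem_erase, and_comm (a := s ≠ t)]
      refine or_congr_right (and_congr_right fun _ => ⟨fun h1 h2 => absurd h2 h1, ?_⟩)
      rintro h1 rfl
      exact (h1 rfl).ne heq.symm
    · rw [stateRank, stateRank, Prod.Lex.toLex_lt_toLex, Prod.Lex.toLex_lt_toLex]
      exact Or.inr ⟨rfl, Or.inl (by norm_num)⟩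
  | append t S ν G g hdeg hg hne =>
    obtain ⟨t, rfl, hh, hν⟩ := hc
    rw [Nat.add_sub_cancel] at hne
    refine ⟨hh.succ K hν hdeg (columnsGenerate_append hp hh.generate hν hg) fun s => ?_, ?_⟩
    · rw [Finset.mem_insert]
      refine or_congr_right ⟨fun h1 => ⟨h1, ?_⟩, fun h1 => h1.1⟩
      rintro rfl
      exact lt_of_le_of_ne ((hh.minimal s le_rfl).degree_le hν s.le_succ) hne.symm
    · rw [stateRank, stateRank, Prod.Lex.toLex_lt_toLex, Prod.Lex.toLex_lt_toLex]
      exact Or.inr ⟨rfl, Or.inl (by norm_num)⟩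

theorem StateInv.exists_step (hp : Prime p) {c : State D n} (hc : StateInv K e B p μ c) :
    (∃ S ν, c = .halt S ν) ∨ ∃ c', Step K e B p c c' := by
  cases c with
  | head t S ν G =>
    right
    have hcard : Fintype.card ((Fin 1 ⊕ Fin (n ^ 2)) ⊕ Fin G.length) =
        Fintype.card (Fin (n ^ 2) ⊕ Fin (G.length + 1)) := by
      simp only [Fintype.card_sum, Fintype.card_fin]
      omega
    obtain ⟨F, hF⟩ := exists_lifting hp (Fintype.equivOfCardEq hcard) (t := t) (mcCoyMatrix e B)
      (ofColumns G) (fun j => by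
        have h := hc.generate
        rw [ColumnsGenerate] at h
        rw [← h]
        exact Submodule.subset_span ⟨Sum.inr j, rfl⟩)
    exact ⟨_, .lift t S ν G F hF⟩
  | lifted t S ν G F => exact Or.inr ⟨_, .call t S ν G F⟩
  | computing t S ν G c =>
    right
    obtain ⟨t, rfl, hh, hc⟩ := hc
    rcases hc.exists_step hp (hh.minimal t le_rfl) with ⟨g, rfl⟩ | ⟨c', hc'⟩
    · exact ⟨_, .assign (t + 1) S ν G g⟩
    · exact ⟨_, .run (t + 1) S ν G c c' hc'⟩
  | assigned t S ν G =>
    right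
    obtain ⟨t, rfl, hh, hν⟩ := hc
    rcases le_or_gt (minpoly K (B.map (algebraMap D K))).degree (ν (t + 1)).degree with hdeg | hdeg
    · exact ⟨_, .ret (t + 1) S ν G hdeg⟩
    · obtain ⟨g, hg⟩ := exists_isQuotientVector e B (ν (t + 1))
      by_cases heq : (ν (t + 1)).degree = (ν t).degree
      · obtain ⟨G', a, rfl, -⟩ := hh.columns (hh.ne_zero_of_degree_eq K hp hν hdeg heq)
        exact ⟨_, .replace (t + 1) S ν G' a g hdeg hg heq⟩
      · exact ⟨_, .append (t + 1) S ν G g hdeg hg heq⟩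
  | halt S ν => exact Or.inl ⟨S, ν, rfl⟩

end Main
end PMinimal

theorem mainTheorem1 {D : Type*} [CommRing D] [IsDomain D] [IsPrincipalIdealRing D]
    (K : Type*) [Field K] [Algebra D K] [IsFractionRing D K]
    {n : ℕ} (B : Matrix (Fin n) (Fin n) D) (p : D) (hp : Prime p)
    (e : Fin (n ^ 2) ≃ Fin n × Fin n) :
    -- no run is infinite
    (¬ ∃ c : ℕ → PMinimal.State D n, c 0 = PMinimal.State.init D n ∧
      ∀ i, PMinimal.Step K e B p (c i) (c (i + 1))) ∧
    -- no run gets stuck before it has returned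
    (∀ c, PMinimal.Reachable K e B p c →
      (∃ S ν, c = PMinimal.State.halt S ν) ∨ ∃ c', PMinimal.Step K e B p c c') ∧
    -- the intermediate assertions hold
    (∀ c, PMinimal.Reachable K e B p c → PMinimal.Assertion e B p c) ∧
    -- whatever is returned is correct
    (∃ μ : Polynomial D,
      μ.map (algebraMap D K) = minpoly K (B.map (algebraMap D K)) ∧
      ∀ S ν, PMinimal.Reachable K e B p (PMinimal.State.halt S ν) →
        PMinimal.DescribesIdeals B p μ S ν) := by
  obtain ⟨μ, hμ, hμm, hμB⟩ := PMinimal.exists_map_eq_minpoly K B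
  obtain ⟨N, hN⟩ := PMinimal.exists_bound K hp B
  have hinit : PMinimal.StateInv K e B p μ (PMinimal.State.init D n) := PMinimal.headInv_zero K
  have hreach : ∀ c, PMinimal.Reachable K e B p c → PMinimal.StateInv K e B p μ c := by
    intro c hc
    induction hc with
    | refl => exact hinit
    | tail _ hstep ih => exact (ih.step K hp hμ hμm hμB hN hstep).1
  refine ⟨?_, fun c hc => (hreach c hc).exists_step K hp, fun c hc => (hreach c hc).assertion K,
    μ, hμ, fun S ν hc => hreach _ hc⟩
  rintro ⟨c, hc0, hc⟩
  have hinv : ∀ i, PMinimal.StateInv K e B p μ (c i) := by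
    intro i
    induction i with
    | zero => rw [hc0]; exact hinit
    | succ i ih => exact (ih.step K hp hμ hμm hμB hN (hc i)).1
  exact not_strictAnti_of_wellFoundedLT (fun i => PMinimal.stateRank N (c i))
    (strictAnti_nat_of_succ_lt fun i => ((hinv i).step K hp hμ hμm hμB hN (hc i)).2)
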